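/- Let $K$ be an algebraically closed field of characteristic $0$. Let $B\subset\mathbb{G}(k,N)$ be an irreducible closed subvariety of dimension $n$, $n\le N-k$, of the Grassmannian of $k$-dimensional linear subspaces of $\mathbb{P}^N_K$, and let $X\subset\mathbb{P}^N$ be the union of the $k$-spaces belonging to $B$. Let $B'\to B$ be a desingularization (with $B'$ projective), let $\mathcal{I}=\{(b,x)\in B'\times\mathbb{P}^N : x\in\Lambda_b\}$ be the incidence correspondence, where $\Lambda_b$ denotes the $k$-space corresponding to the image of $b$ in $B$, and let $g:\mathcal{I}\to B$ and $f:\mathcal{I}\to\mathbb{P}^N$ be the natural maps. The characteristic map at $q=(b,x)\in\mathcal{I}$ is the linear map $$\chi_q:\ T_bB'\longrightarrow T_q(B'\times\mathbb{P}^N)/T_q\mathcal{I},\qquad \tau\mapsto[(\tau,0)].$$ Let $V(\chi)\subset\mathcal{I}$ be the set of the points $q$ at which $\operatorname{rank}\chi_q<\min\{n,N-k\}$. The focal locus is $F=f(V(\chi))\subset\mathbb{P}^N$, with its reduced structure; the points $x$ with $(b,x)\in V(\chi)$ are the focal points on $\Lambda_b$. The fundamental locus $\Phi$ is the set of the points $x$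 whose fibre $f^{-1}(x)$ has positive dimension. Suppose that $\dim X=n+k$ and that the focal locus has codimension $1$ in $X$, in the following sense: $\dim F=n+k-1$, and $\dim f(W)=n+k-1$ for every irreducible component $W$ of $V(\chi)$ such that $g(W)$ is dense in $B$ and $f(W)\not\subset\Phi$. Then a general $\Lambda\in B$ is tangent to $F$ at all focal points on $\Lambda$ that are not fundamental: there is a non-empty open subset $O$ of $B$ such that, for every $\Lambda\in O$, every $b\in B'$ with $\Lambda_b=\Lambda$, and every $x\in\Lambda$ with $(b,x)\in V(\chi)$ and $x\notin\Phi$, the space $\Lambda$ is contained in the embedded (Zariski) tangent space $\mathbb{T}_xF\subset\mathbb{P}^N$. -/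

import Mathlib

noncomputable section

namespace Focal

open Module MvPolynomial

/-! ### Affine space -/

/-- The Zariski topology on the affine space `K^ι`: the closed sets are the common zero sets of
families of polynomials. -/
@[reducible] def zariski (K : Type*) [Field K] (ι : Type*) : TopologicalSpace (ι → K) :=
  TopologicalSpace.ofClosed
    {Z | ∃ S : Set (MvPolynomial ι K), Z = {v | ∀ p ∈ S, eval v p = 0}}
    ⟨{1}, by ext v; simp⟩
    (by
      intro A hA
      refine ⟨{p | ∃ Z ∈ A, ∀ v ∈ Z, eval v p = 0}, ?_⟩
      ext v
      constructor
      · intro hv p hp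
        obtain ⟨Z, hZ, hp⟩ := hp
        exact hp v (hv Z hZ)
      · intro hv Z hZ
        obtain ⟨S, rfl⟩ := hA hZ
        exact fun p hp => hv p ⟨_, hZ, fun w hw => hw p hp⟩)
    (by
      rintro Z ⟨S, rfl⟩ Z' ⟨S', rfl⟩
      refine ⟨{r | ∃ p ∈ S, ∃ q ∈ S', r = p * q}, ?_⟩
      ext v
      constructor
      · rintro (hv | hv) r ⟨p, hp, q, hq, rfl⟩
        · simp [hv p hp]
        · simp [hv q hq]
      · intro hv
        by_contra hcon
        simp only [Set.mem_union, Set.mem_ofPred_eq, not_or, not_forall] at hcon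
        obtain ⟨⟨p, hp, hp0⟩, q, hq, hq0⟩ := hcon
        have h := hv (p * q) ⟨p, hp, q, hq, rfl⟩
        rw [map_mul] at h
        exact (mul_ne_zero hp0 hq0) h)

/-- The Zariski tangent space at `v` of the (reduced) closed subset of `K^ι` defined by all
polynomials that vanish on `C`, as a linear subspace of `K^ι`. -/
def zariskiTangent {K : Type*} [Field K] {ι : Type*} [Fintype ι] (C : Set (ι → K)) (v : ι → K) :
    Submodule K (ι → K) where
  carrier := {w | ∀ p : MvPolynomial ι K, (∀ c ∈ C, eval c p = 0) →
    ∑ i, w i * eval v (pderiv i p) = 0}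
  zero_mem' := by intro p _; simp
  add_mem' := by
    intro w w' hw hw' p hp
    simp [add_mul, Finset.sum_add_distrib, hw p hp, hw' p hp]
  smul_mem' := by
    intro a w hw p hp
    simp [mul_assoc, ← Finset.mul_sum, hw p hp]

/-! ### Projective space, products of two projective spaces, Grassmannians -/

/-- The projective space of dimension `N` over `K`. -/
abbrev ProjSpace (K : Type*) [Field K] (N : ℕ) : Type _ :=
  Projectivization K (Fin (N + 1) → K)

/-- The Zariski topology on projective space, as a quotient of `K^(N+1)` without the origin. -/
instance ProjSpace.instTopologicalSpace (K : Type*) [Field K] (N : ℕ) :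
    TopologicalSpace (ProjSpace K N) :=
  TopologicalSpace.coinduced
    (fun v : {v : Fin (N + 1) → K // v ≠ 0} => Projectivization.mk K v.1 v.2)
    (TopologicalSpace.induced Subtype.val (zariski K (Fin (N + 1))))

/-- The product variety `ℙ^M × ℙ^N`. A definition of its own, because its Zariski topology is not
the product topology. -/
def BiProjSpace (K : Type*) [Field K] (M N : ℕ) : Type _ :=
  ProjSpace K M × ProjSpace K N

/-- The Zariski topology on `ℙ^M × ℙ^N` (closed sets are given by bihomogeneous equations), as a
quotient of the set of the pairs of non-zero vectors. -/
instance BiProjSpace.instTopologicalSpace (K : Type*) [Field K] (M N : ℕ) :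
    TopologicalSpace (BiProjSpace K M N) :=
  TopologicalSpace.coinduced
    (fun z : {z : (Fin (M + 1) → K) × (Fin (N + 1) → K) // z.1 ≠ 0 ∧ z.2 ≠ 0} =>
      ((Projectivization.mk K z.1.1 z.2.1, Projectivization.mk K z.1.2 z.2.2) :
        BiProjSpace K M N))
    (TopologicalSpace.induced (fun z => Sum.elim z.1.1 z.1.2)
      (zariski K (Fin (M + 1) ⊕ Fin (N + 1))))

/-- The Grassmannian of the `k`-dimensional projective subspaces of `ℙ^N`, that is of the linear
subspaces of dimension `k + 1` of `K^(N+1)`. -/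
def Grass (K : Type*) [Field K] (N k : ℕ) : Type _ :=
  {L : Submodule K (Fin (N + 1) → K) // finrank K L = k + 1}

/-- Frames: linearly independent families of `k + 1` vectors of `K^(N+1)`. -/
abbrev Frame (K : Type*) [Field K] (N k : ℕ) : Type _ :=
  {A : Fin (k + 1) → Fin (N + 1) → K // LinearIndependent K A}

/-- The matrix entries of a family of vectors, as one point of an affine space. -/
def entries {K : Type*} {N k : ℕ} (A : Fin (k + 1) → Fin (N + 1) → K) :
    Fin (k + 1) × Fin (N + 1) → K :=
  fun ij => A ij.1 ij.2

/-- The point of the Grassmannian spanned by a frame. -/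
def Frame.span {K : Type*} [Field K] {N k : ℕ} (A : Frame K N k) : Grass K N k :=
  ⟨Submodule.span K (Set.range A.1), by rw [finrank_span_eq_card A.2]; simp⟩

/-- The Zariski topology on the Grassmannian, as the quotient of the space of frames (an open
subset of the affine space of matrices) by the change of frame. -/
instance Grass.instTopologicalSpace (K : Type*) [Field K] (N k : ℕ) :
    TopologicalSpace (Grass K N k) :=
  TopologicalSpace.coinduced (Frame.span : Frame K N k → Grass K N k)
    (TopologicalSpace.induced (fun A => entries A.1) (zariski K (Fin (k + 1) × Fin (N + 1))))

/-- The point `x` of `ℙ^N` lies on the projective subspace `L`. -/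
def Grass.Contains {K : Type*} [Field K] {N k : ℕ} (L : Grass K N k) (x : ProjSpace K N) : Prop :=
  x.submodule ≤ L.1

/-- The affine cone (without the origin) over a subset of `ℙ^N`. -/
def cone {K : Type*} [Field K] {N : ℕ} (Z : Set (ProjSpace K N)) : Set (Fin (N + 1) → K) :=
  {v | ∃ h : v ≠ 0, Projectivization.mk K v h ∈ Z}

/-- The affine bicone (without the pairs with a zero component) over a subset of `ℙ^M × ℙ^N`. -/
def bicone {K : Type*} [Field K] {M N : ℕ} (Z : Set (BiProjSpace K M N)) :
    Set (Fin (M + 1) ⊕ Fin (N + 1) → K) :=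
  {z | ∃ (u : Fin (M + 1) → K) (v : Fin (N + 1) → K) (hu : u ≠ 0) (hv : v ≠ 0),
    z = Sum.elim u v ∧
      ((Projectivization.mk K u hu, Projectivization.mk K v hv) : BiProjSpace K M N) ∈ Z}

/-- The embedded tangent space at `x` of a closed subset `Z` of `ℙ^N` (with its reduced
structure), as a linear subspace of `K^(N+1)`: the Zariski tangent space of the affine cone. It is
independent of the representative of `x`, and the tangent space `T_x Z` is its quotient by the line
`x`. -/
def embTangent {K : Type*} [Field K] {N : ℕ} (Z : Set (ProjSpace K N)) (x : ProjSpace K N) :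
    Submodule K (Fin (N + 1) → K) :=
  zariskiTangent (cone Z) x.rep

/-- The closed subset `Y` of `ℙ^M` is non-singular (of the same dimension at all its points). -/
def IsNonsingular {K : Type*} [Field K] {M : ℕ} (Y : Set (ProjSpace K M)) : Prop :=
  ∀ y ∈ Y, ((finrank K (embTangent Y y) : ℕ) : WithBot ℕ∞) = topologicalKrullDim Y + 1

/-! ### Regular maps to and from a Grassmannian -/

/-- A map from a subset of `ℙ^M` to a Grassmannian is regular if around every point it is given by
a frame whose entries are homogeneous polynomials of one and the same degree. -/
def IsRegularToGrass {K : Type*} [Field K] {M N k : ℕ} {Y : Set (ProjSpace K M)}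
    (φ : Y → Grass K N k) : Prop :=
  ∀ y : Y, ∃ (d : ℕ) (A : Fin (k + 1) → Fin (N + 1) → MvPolynomial (Fin (M + 1)) K),
    (∀ i j, (A i j).IsHomogeneous d) ∧
    LinearIndependent K (fun i j => eval y.1.rep (A i j)) ∧
    ∀ (z : Y) (h : LinearIndependent K (fun i j => eval z.1.rep (A i j))),
      φ z = Frame.span ⟨_, h⟩

/-- A map from a subset of a Grassmannian to `ℙ^M` is regular if around every point its homogeneous
coordinates are polynomials in the entries of a frame. -/
def IsRegularFromGrass {K : Type*} [Field K] {M N k : ℕ} {S : Set (Grass K N k)}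
    (ψ : S → ProjSpace K M) : Prop :=
  ∀ A₀ : Frame K N k, A₀.span ∈ S →
    ∃ P : Fin (M + 1) → MvPolynomial (Fin (k + 1) × Fin (N + 1)) K,
      (fun j => eval (entries A₀.1) (P j)) ≠ 0 ∧
      ∀ (A : Frame K N k) (hA : A.span ∈ S) (hP : (fun j => eval (entries A.1) (P j)) ≠ 0),
        ψ ⟨A.span, hA⟩ = Projectivization.mk K (fun j => eval (entries A.1) (P j)) hP

/-- A desingularization of a closed subvariety `B` of a Grassmannian: a non-singular projective
variety `B'` with a surjective birational morphism to `B`. -/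
structure Desingularization {K : Type*} [Field K] {N k : ℕ} (B : Set (Grass K N k)) where
  /-- The dimension of a projective space containing `B'`. -/
  M : ℕ
  /-- The variety `B'`. -/
  carrier : Set (ProjSpace K M)
  isClosed_carrier : IsClosed carrier
  isIrreducible_carrier : IsIrreducible carrier
  nonsingular : IsNonsingular carrier
  /-- The morphism from `B'` to `B`. -/
  toGrass : carrier → Grass K N k
  regular : IsRegularToGrass toGrass
  range_eq : Set.range toGrass = B
  /-- There is a regular inverse over a non-empty open subset of `B`. -/
  birational : ∃ O : Set (Grass K N k), IsOpen O ∧ (B ∩ O).Nonempty ∧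
    ∃ σ : (B ∩ O : Set (Grass K N k)) → ProjSpace K M, IsRegularFromGrass σ ∧
      ∀ (y : carrier) (hy : toGrass y ∈ B ∩ O), σ ⟨toGrass y, hy⟩ = y.1

/-! ### Families of linear spaces and their foci -/

/-- The union of the projective subspaces that belong to `B`. -/
def sweptOut {K : Type*} [Field K] {N k : ℕ} (B : Set (Grass K N k)) : Set (ProjSpace K N) :=
  {x | ∃ L ∈ B, L.Contains x}

namespace Desingularization

variable {K : Type*} [Field K] {N k : ℕ} {B : Set (Grass K N k)}

/-- The incidence correspondence `I` in `B' × ℙ^N`. -/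
def incidence (D : Desingularization B) : Set (BiProjSpace K D.M N) :=
  {q | ∃ h : q.1 ∈ D.carrier, (D.toGrass ⟨q.1, h⟩).Contains q.2}

/-- The fundamental locus: the points `x` over which the fibre of `f : I → ℙ^N` (that is, the set
of the `b` in `B'` whose linear space contains `x`) has positive dimension. -/
def fundamentalLocus (D : Desingularization B) : Set (ProjSpace K N) :=
  {x | 0 < topologicalKrullDim
    {b : ProjSpace K D.M | ∃ h : b ∈ D.carrier, (D.toGrass ⟨b, h⟩).Contains x}}

/-- The tangent space of the bicone over `I` at (representatives of) `q`. Its quotient by the span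
of the two lines of `q` is the tangent space `T_q I`. -/
def incidenceTangent (D : Desingularization B) (q : BiProjSpace K D.M N) :
    Submodule K (Fin (D.M + 1) ⊕ Fin (N + 1) → K) :=
  zariskiTangent (bicone D.incidence) (Sum.elim q.1.rep q.2.rep)

/-- The characteristic map at `q = (b, x)`: it sends a vector tangent to `B'` at `b`, regarded as
a vector `(τ, 0)` tangent to `B' × ℙ^N` at `q`, to its class modulo `T_q I`.
It is written on the affine cones: the source is `T_b B'` enlarged by the line `b`, on which the
map vanishes, and the target contains the normal space `T_q (B' × ℙ^N) / T_q I`, in which the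
values lie; so the rank is that of the characteristic map. -/
def characteristicMap (D : Desingularization B) (q : BiProjSpace K D.M N) :
    embTangent D.carrier q.1 →ₗ[K]
      ((Fin (D.M + 1) ⊕ Fin (N + 1) → K) ⧸ D.incidenceTangent q) :=
  (D.incidenceTangent q).mkQ ∘ₗ
    ((LinearEquiv.sumArrowLequivProdArrow (Fin (D.M + 1)) (Fin (N + 1)) K K).symm.toLinearMap ∘ₗ
      LinearMap.inl K (Fin (D.M + 1) → K) (Fin (N + 1) → K)) ∘ₗ
    (embTangent D.carrier q.1).subtype

/-- The (support of the) subscheme of foci in `I`: the points at which the rank of the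
characteristic map is less than the minimum of the rank `dim T_b B'` of the pulled back tangent
bundle and the rank `N - k` of the normal bundle. -/
def foci (D : Desingularization B) : Set (BiProjSpace K D.M N) :=
  {q | q ∈ D.incidence ∧ finrank K (LinearMap.range (D.characteristicMap q)) <
    min (finrank K (embTangent D.carrier q.1) - 1) (N - k)}

/-- The image in `ℙ^N` of a subset of `B' × ℙ^N`. -/
def imageInSpace (D : Desingularization B) (W : Set (BiProjSpace K D.M N)) :
    Set (ProjSpace K N) :=
  {x | ∃ q ∈ W, q.2 = x}

/-- The image in `B` of a subset of `B' × ℙ^N`. -/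
def imageInBase (D : Desingularization B) (W : Set (BiProjSpace K D.M N)) :
    Set (Grass K N k) :=
  {L | ∃ q ∈ W, ∃ h : q.1 ∈ D.carrier, D.toGrass ⟨q.1, h⟩ = L}

/-- The focal locus in `ℙ^N`. -/
def focalLocus (D : Desingularization B) : Set (ProjSpace K N) :=
  D.imageInSpace D.foci

/-- `W` is an irreducible component of the set of foci in `I`. -/
def IsFocalComponent (D : Desingularization B) (W : Set (BiProjSpace K D.M N)) : Prop :=
  Maximal (fun Z : Set (BiProjSpace K D.M N) => IsIrreducible Z ∧ Z ⊆ D.foci) W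

end Desingularization

end Focal

end

noncomputable section

namespace Focal

open Module MvPolynomial

/-! ### Derivations dual to algebraically independent elements -/

/-! Tangent spaces are computed on affine cones and bicones, which adds one to the dimension for
each projective factor. Write `I` for the incidence correspondence and `f` for its projection to
projective space. Since `B'` is nonsingular of dimension at most `n`, the tangent space of the
bicone over `I` at `(b, x)` has dimension at most `(n + 1) + (k + 1)`: it projects into the tangent
space of the cone over `B'`, and its vertical vectors lie in `Λ_b`. At a focus the characteristic
map has a kernel of dimension at least two on cones, namely the line `b` and one more direction.
This kernel is tangent to `I` and is killed by `df`, so `df(T I)` has dimension at most `n + k`.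

Let `W` be an irreducible set of foci whose image has dimension `n + k - 1`. In characteristic zero,
`df(T W)` has dimension at least `n + k` at a general point of `W`. It is contained in `df(T I)`, so
the two coincide. Now `df(T I)` contains `Λ_b`, because `{b} × Λ_b` lies in `I`, and `df(T W)` lies
in the tangent space of the focal locus; hence `Λ_b` is tangent there. Tangency is a closed
condition on the irreducible `W`, so it holds at every point of `W`. A general `Λ` avoids the images
of the finitely many focal components that do not dominate `B`; every non-fundamental focus over it
then lies on a component to which the codimension hypothesis applies.

The dimension count is `le_embTangent_focalLocus`. The generic rank is
`exists_le_finrank_map_toSpace`, which turns derivations dual to independent coordinates into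
tangent vectors. Extension to all of `W` is `le_embTangent_of_mem`. The bound on the tangent spaces
of `B'` is `finrank_embTangent_le`; it needs a comparison of topological dimensions, obtained by
embedding a hyperplane slice of the cone over `B'` in `B` by means of the birational inverse. -/

/-- In characteristic zero, there are derivations that are dual to given algebraically independent
elements. -/
theorem exists_derivation_dual_of_isTranscendenceBasis {K L : Type*} [Field K] [CharZero K]
    [Field L] [Algebra K L] {ι : Type*} [DecidableEq ι] {x : ι → L}
    (hx : IsTranscendenceBasis K x) :
    ∃ D : ι → Derivation K L L, ∀ i j, D i (x j) = if i = j then 1 else 0 := by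
  let : Algebra (MvPolynomial ι K) L := (aeval x).toAlgebra
  have hmap : ∀ p : MvPolynomial ι K, algebraMap (MvPolynomial ι K) L p = aeval x p := fun _ => rfl
  have : IsScalarTower K (MvPolynomial ι K) L :=
    IsScalarTower.of_algebraMap_eq fun r => by rw [hmap]; simp
  have hinj : Function.Injective (algebraMap (MvPolynomial ι K) L) := hx.1
  have : FaithfulSMul (MvPolynomial ι K) L := (faithfulSMul_iff_algebraMap_injective _ _).2 hinj
  have halg : Algebra.IsAlgebraic (MvPolynomial ι K) L := by
    have := hx.isAlgebraic
    refine Algebra.IsAlgebraic.of_ringHom_of_comp_eq (S := Algebra.adjoin K (Set.range x))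
      (hx.1.aevalEquiv : MvPolynomial ι K →+* Algebra.adjoin K (Set.range x))
      (RingHom.id L) hx.1.aevalEquiv.surjective Function.injective_id ?_
    refine RingHom.ext fun p => ?_
    simp [hmap]
  let : Algebra (FractionRing (MvPolynomial ι K)) L := FractionRing.liftAlgebra _ _
  have : IsScalarTower (MvPolynomial ι K) (FractionRing (MvPolynomial ι K)) L :=
    FractionRing.isScalarTower_liftAlgebra _ _
  have : IsScalarTower K (FractionRing (MvPolynomial ι K)) L :=
    IsScalarTower.to₁₃₄ K (MvPolynomial ι K) _ _
  have : Algebra.IsAlgebraic (FractionRing (MvPolynomial ι K)) L :=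
    Algebra.IsAlgebraic.extendScalars (R := MvPolynomial ι K) (IsFractionRing.injective _ _)
  have : CharZero (FractionRing (MvPolynomial ι K)) :=
    charZero_of_injective_algebraMap
      (IsFractionRing.injective (MvPolynomial ι K) (FractionRing (MvPolynomial ι K)))
  -- `K[x] → K(x)` is a localization and `K(x) → L` is algebraic, hence separable in characteristic
  -- zero. The composite is formally étale, so derivations of `K[x]` with values in `L` extend to
  -- `L`.
  have : Algebra.FormallyEtale (MvPolynomial ι K) (FractionRing (MvPolynomial ι K)) :=
    Algebra.FormallyEtale.of_isLocalization (nonZeroDivisors (MvPolynomial ι K))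
  have : Algebra.FormallyEtale (FractionRing (MvPolynomial ι K)) L :=
    Algebra.FormallyEtale.of_isSeparable _ _
  have : Algebra.FormallyEtale (MvPolynomial ι K) L :=
    Algebra.FormallyEtale.comp _ (FractionRing (MvPolynomial ι K)) _
  let d : ι → Derivation K (MvPolynomial ι K) L := fun i =>
    mkDerivation K fun j => if i = j then (1 : L) else 0
  refine ⟨fun i => ((d i).liftKaehlerDifferential.liftBaseChange L ∘ₗ
    (KaehlerDifferential.tensorKaehlerEquivOfFormallyEtale K
      (MvPolynomial ι K) L).symm.toLinearMap).compDer (KaehlerDifferential.D K L), fun i j => ?_⟩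
  have hxj : x j = algebraMap (MvPolynomial ι K) L (X j) := by rw [hmap]; simp
  rw [hxj]
  simp [d, KaehlerDifferential.tensorKaehlerEquivOfFormallyEtale_symm_D_algebraMap,
    mkDerivation_X]

theorem exists_derivation_dual {K L : Type*} [Field K] [CharZero K]
    [Field L] [Algebra K L] {ι : Type*} [DecidableEq ι] {x : ι → L}
    (hx : AlgebraicIndependent K x) :
    ∃ D : ι → Derivation K L L, ∀ i j, D i (x j) = if i = j then 1 else 0 := by
  classical
  obtain ⟨t, hxt, ht⟩ := exists_isTranscendenceBasis_superset
    (s := Set.range x) ((algebraicIndependent_subtype_range hx.injective).2 hx)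
  obtain ⟨D, hD⟩ := exists_derivation_dual_of_isTranscendenceBasis ht
  refine ⟨fun i => D ⟨x i, hxt ⟨i, rfl⟩⟩, fun i j => ?_⟩
  have := hD ⟨x i, hxt ⟨i, rfl⟩⟩ ⟨x j, hxt ⟨j, rfl⟩⟩
  simpa [hx.injective.eq_iff] using this

/-- A derivation of the values of a polynomial is given by its partial derivatives. -/
theorem derivation_aeval {K L : Type*} [Field K] [Field L] [Algebra K L] {σ : Type*} [Fintype σ]
    (D : Derivation K L L) (y : σ → L) (p : MvPolynomial σ K) :
    D (aeval y p) = ∑ i, D (y i) * aeval y (pderiv i p) := by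
  classical
  induction p using MvPolynomial.induction_on with
  | C a => simp
  | add p q hp hq => simp [hp, hq, mul_add, Finset.sum_add_distrib]
  | mul_X p n hp =>
    have h1 : ∀ i, D (y i) * aeval y (pderiv i (p * X n)) =
        D (y i) * aeval y p * (if i = n then 1 else 0) +
          y n * (D (y i) * aeval y (pderiv i p)) := by
      intro i
      rw [Derivation.leibniz, pderiv_X, Pi.single_apply]
      split_ifs with h h' h'
      · simp; ring
      · exact absurd h.symm h'
      · exact absurd h'.symm h
      · simp; ring
    simp_rw [h1]
    rw [Finset.sum_add_distrib, ← Finset.mul_sum, ← hp, map_mul, aeval_X, Derivation.leibniz]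
    simp [mul_comm]

/-- Vectors tangent to a variety along which given algebraically independent coordinates are dual
coordinates, at the points outside a hypersurface. -/
theorem exists_tangent_vectors {K : Type*} [Field K] [CharZero K] {σ : Type*} [Fintype σ]
    (P : Ideal (MvPolynomial σ K)) [P.IsPrime] {ι : Type*} [Finite ι] [DecidableEq ι] (x : ι → σ)
    (hx : AlgebraicIndependent K fun i => Ideal.Quotient.mk P (X (x i))) :
    ∃ (H : MvPolynomial σ K) (w : ι → σ → MvPolynomial σ K), H ∉ P ∧
      (∀ i j, w i (x j) - (if i = j then H else 0) ∈ P) ∧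
      ∀ i, ∀ p ∈ P, ∑ s, w i s * pderiv s p ∈ P := by
  classical
  have := Fintype.ofFinite ι
  let A := MvPolynomial σ K ⧸ P
  let L := FractionRing A
  let y : σ → L := fun s => algebraMap A L (Ideal.Quotient.mk P (X s))
  have hinj : Function.Injective (algebraMap A L) := IsFractionRing.injective A L
  have hy : ∀ p, aeval y p = algebraMap A L (Ideal.Quotient.mk P p) := by
    intro p
    have : (aeval y : MvPolynomial σ K →ₐ[K] L) =
        (IsScalarTower.toAlgHom K A L).comp (Ideal.Quotient.mkₐ K P) := by
      ext s; simp [y, A]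
    rw [this]; simp [A]
  have hy0 : ∀ p, aeval y p = 0 ↔ p ∈ P := by
    intro p
    rw [hy, map_eq_zero_iff _ hinj, Ideal.Quotient.eq_zero_iff_mem]
  have hxy : AlgebraicIndependent K fun i => y (x i) :=
    hx.map' (f := IsScalarTower.toAlgHom K A L) hinj
  obtain ⟨D, hD⟩ := exists_derivation_dual hxy
  -- `b` is a common denominator of all `D i (y s)`. Lifting `b` to `H` and `b * D i (y s)` to `w i
  -- s` gives vector fields with polynomial coefficients.
  obtain ⟨b, hb⟩ := IsLocalization.exist_integer_multiples_of_finset (nonZeroDivisors A)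
    (Finset.univ.image fun q : ι × σ => D q.1 (y q.2))
  have hb' : ∀ i s, ∃ p : MvPolynomial σ K, aeval y p = algebraMap A L b * D i (y s) := by
    intro i s
    obtain ⟨a, ha⟩ := hb (D i (y s)) (Finset.mem_image.2 ⟨(i, s), Finset.mem_univ _, rfl⟩)
    obtain ⟨p, rfl⟩ := Ideal.Quotient.mk_surjective a
    exact ⟨p, by rw [hy, ha, Algebra.smul_def]⟩
  choose w hw using hb'
  obtain ⟨H, hH⟩ := Ideal.Quotient.mk_surjective (b : A)
  have hHy : aeval y H = algebraMap A L b := by rw [hy, hH]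
  refine ⟨H, w, ?_, ?_, ?_⟩
  · rw [← hy0, hHy, map_eq_zero_iff _ hinj]
    exact nonZeroDivisors.ne_zero b.2
  · intro i j
    rw [← hy0, map_sub, hw, hD]
    split_ifs <;> simp [hHy]
  · intro i p hp
    have h := derivation_aeval (D i) y p
    rw [(hy0 p).2 hp, map_zero] at h
    rw [← hy0, map_sum]
    simp only [map_mul, hw, mul_assoc, ← Finset.mul_sum, ← h, mul_zero]

/-! ### Krull dimension of finitely generated algebras -/

/-- Incomparability: contraction is strictly monotone on primes. -/
theorem ringKrullDim_le_of_isIntegral {R S : Type*} [CommRing R] [CommRing S] [Algebra R S]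
    [Algebra.IsIntegral R S] : ringKrullDim S ≤ ringKrullDim R := by
  refine Order.krullDim_le_of_strictMono (PrimeSpectrum.comap (algebraMap R S)) fun p q hpq => ?_
  obtain ⟨x, hxq, hxp⟩ := SetLike.exists_of_lt (show p.asIdeal < q.asIdeal from hpq)
  exact Ideal.comap_lt_comap_of_integral_mem_sdiff hpq.le ⟨hxq, hxp⟩
    (Algebra.IsIntegral.isIntegral x)

/-- Lying over for the bottom of a chain of primes, then going up for the rest. -/
theorem ringKrullDim_le_of_isIntegral_of_injective {R S : Type*} [CommRing R] [CommRing S]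
    [Algebra R S] [Algebra.IsIntegral R S] (h : Function.Injective (algebraMap R S)) :
    ringKrullDim R ≤ ringKrullDim S := by
  refine iSup_le fun l => ?_
  have : FaithfulSMul R S := (faithfulSMul_iff_algebraMap_injective _ _).2 h
  obtain ⟨Q, -, hQ, hQl⟩ := Ideal.exists_ideal_over_prime_of_isIntegral l.head.asIdeal (⊥ : Ideal S)
    (by simp [← RingHom.ker_eq_comap_bot])
  have : Q.LiesOver l.head.asIdeal := ⟨hQl.symm⟩
  obtain ⟨M, hM, -⟩ := Ideal.exists_ltSeries_of_hasGoingUp l Q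
  rw [← hM]
  exact le_iSup (fun l : LTSeries (PrimeSpectrum S) => ((l.length : ℕ) : WithBot ℕ∞)) M

/-- The Krull dimension of a finitely generated domain is its transcendence degree. -/
theorem ringKrullDim_eq_of_isTranscendenceBasis {K A : Type*} [Field K] [CommRing A] [IsDomain A]
    [Algebra K A] [Algebra.FiniteType K A] {ι : Type*} [Finite ι] {x : ι → A}
    (hx : IsTranscendenceBasis K x) : ringKrullDim A = Nat.card ι := by
  -- By Noether normalization, `s` is both the Krull dimension and the transcendence degree.
  obtain ⟨s, g, hg, hint⟩ := exists_integral_inj_algHom_of_fg K A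
  let : Algebra (MvPolynomial (Fin s) K) A := g.toRingHom.toAlgebra
  have hmap : ∀ p, algebraMap (MvPolynomial (Fin s) K) A p = g p := fun _ => rfl
  have : IsScalarTower K (MvPolynomial (Fin s) K) A :=
    IsScalarTower.of_algebraMap_eq fun r => by rw [hmap]; simp
  have : Algebra.IsIntegral (MvPolynomial (Fin s) K) A := ⟨hint⟩
  have hdim : ringKrullDim A = s := by
    have h := le_antisymm (ringKrullDim_le_of_isIntegral (R := MvPolynomial (Fin s) K) (S := A))
      (ringKrullDim_le_of_isIntegral_of_injective hg)
    rw [h]; simp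
  have : FaithfulSMul (MvPolynomial (Fin s) K) A := (faithfulSMul_iff_algebraMap_injective _ _).2 hg
  have hb : IsTranscendenceBasis K fun i : Fin s => g (X i) :=
    (IsTranscendenceBasis.mvPolynomial (Fin s) K).algebraMap_comp
  have := hx.lift_cardinalMk_eq hb
  rw [hdim]
  have h2 := congrArg Cardinal.toNat this
  simp at h2
  simp [Nat.card, h2]

theorem exists_isTranscendenceBasis_of_adjoin_eq_top {K A : Type*} [Field K] [CommRing A]
    [IsDomain A] [Algebra K A] {σ : Type*} {x : σ → A} (hx : Algebra.adjoin K (Set.range x) = ⊤) :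
    ∃ t : Set σ, IsTranscendenceBasis K fun i : t => x i := by
  have : Algebra.IsAlgebraic (Algebra.adjoin K (Set.range x)) A := by
    rw [hx]
    have := Algebra.isIntegral_of_surjective (R := (⊤ : Subalgebra K A)) (B := A)
      (fun a => ⟨⟨a, trivial⟩, rfl⟩)
    exact Algebra.IsIntegral.isAlgebraic
  have : FaithfulSMul K A :=
    (faithfulSMul_iff_algebraMap_injective _ _).2 (algebraMap K A).injective
  obtain ⟨u, hu, hb⟩ := exists_isTranscendenceBasis_subset (R := K) (Set.range x)
  choose f hf using fun a : u => hu a.2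
  have hinj : Function.Injective f := fun a b h => Subtype.ext (by rw [← hf a, ← hf b, h])
  refine ⟨Set.range f, ?_⟩
  refine (isTranscendenceBasis_equiv' (Equiv.ofInjective f hinj) ?_).1 hb
  ext a
  simp [hf]

theorem exists_isTranscendenceBasis_X {K : Type*} [Field K] {σ : Type*}
    (P : Ideal (MvPolynomial σ K)) [P.IsPrime] :
    ∃ t : Set σ, IsTranscendenceBasis K fun i : t => Ideal.Quotient.mk P (X i.1) := by
  refine exists_isTranscendenceBasis_of_adjoin_eq_top (x := fun i => Ideal.Quotient.mk P (X i)) ?_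
  have := congrArg (Subalgebra.map (Ideal.Quotient.mkₐ K P)) (adjoin_range_X (R := K) (σ := σ))
  rw [AlgHom.map_adjoin, ← Set.range_comp, Algebra.map_top,
    (AlgHom.range_eq_top _).2 (Ideal.Quotient.mkₐ_surjective K P)] at this
  exact this

/-- Taking the independent elements among the coordinates lets the dual derivations be read as
tangent vectors with prescribed entries. -/
theorem exists_algebraicIndependent_X {K : Type*} [Field K] {σ : Type*} [Finite σ]
    (P : Ideal (MvPolynomial σ K)) [P.IsPrime] {d : ℕ}
    (hd : (d : WithBot ℕ∞) ≤ ringKrullDim (MvPolynomial σ K ⧸ P)) :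
    ∃ x : Fin d → σ, AlgebraicIndependent K fun a => Ideal.Quotient.mk P (X (x a)) := by
  obtain ⟨t, ht⟩ := exists_isTranscendenceBasis_X P
  have : Finite t := inferInstance
  have := Fintype.ofFinite t
  rw [ringKrullDim_eq_of_isTranscendenceBasis ht, Nat.card_eq_fintype_card] at hd
  have hd' : d ≤ Fintype.card t := by exact_mod_cast hd
  let e : Fin d ↪ t := (Fin.castLEEmb hd').trans (Fintype.equivFin t).symm.toEmbedding
  exact ⟨fun a => (e a).1, ht.1.comp e e.injective⟩

/-- A transcendence basis survives the inversion of `h`, and it determines both dimensions. -/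
theorem ringKrullDim_localizationAway {K A : Type*} [Field K] [CommRing A] [IsDomain A]
    [Algebra K A] [Algebra.FiniteType K A] {ι : Type*} [Finite ι] {x : ι → A}
    (hx : IsTranscendenceBasis K x) {h : A} (hh : h ≠ 0) :
    ringKrullDim (Localization.Away h) = ringKrullDim A := by
  have hle : Submonoid.powers h ≤ nonZeroDivisors A :=
      powers_le_nonZeroDivisors_of_noZeroDivisors hh
  have : IsDomain (Localization.Away h) := IsLocalization.isDomain_localization hle
  have : Algebra.FiniteType A (Localization.Away h) := IsLocalization.finiteType_of_monoid_fg
    (Submonoid.powers h) _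
  have : Algebra.FiniteType K (Localization.Away h) := Algebra.FiniteType.trans ‹_› this
  have : FaithfulSMul A (Localization.Away h) :=
    (faithfulSMul_iff_algebraMap_injective _ _).2 (IsLocalization.injective _ hle)
  have : Algebra.IsAlgebraic A (Localization.Away h) :=
    IsLocalization.isAlgebraic _ (Submonoid.powers h)
  rw [ringKrullDim_eq_of_isTranscendenceBasis hx,
    ringKrullDim_eq_of_isTranscendenceBasis (hx.algebraMap_comp (A := Localization.Away h))]

/-- Nullstellensatz: the residue field at `m` is finite over `K`, hence equal to `K`. -/
theorem exists_sub_algebraMap_mem {K R : Type*} [Field K] [IsAlgClosed K] [CommRing R]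
    [Algebra K R] [Algebra.FiniteType K R] (m : Ideal R) [m.IsMaximal] (r : R) :
    ∃ c : K, r - algebraMap K R c ∈ m := by
  let : Field (R ⧸ m) := Ideal.Quotient.field m
  have : Algebra.FiniteType K (R ⧸ m) :=
    Algebra.FiniteType.of_surjective (Ideal.Quotient.mkₐ K m) (Ideal.Quotient.mkₐ_surjective K m)
  have : Module.Finite K (R ⧸ m) := finite_of_finite_type_of_isJacobsonRing K (R ⧸ m)
  obtain ⟨c, hc⟩ := (IsAlgClosed.algebraMap_bijective_of_isIntegral (k := K) (K := R ⧸ m)).2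
    (Ideal.Quotient.mk m r)
  refine ⟨c, ?_⟩
  rw [← Ideal.Quotient.eq_zero_iff_mem, map_sub, ← hc]
  simp [← Ideal.Quotient.algebraMap_eq, ← IsScalarTower.algebraMap_apply]

/-- Chains of irreducible subvarieties of a hyperplane section of an affine variety, not contained
in a given hypersurface. -/
theorem exists_ltSeries_hyperplane {K : Type*} [Field K] [IsAlgClosed K] {σ : Type*} [Finite σ]
    (P : Ideal (MvPolynomial σ K)) [P.IsPrime] {h : MvPolynomial σ K} (hh : h ∉ P) (j : σ) {d : ℕ}
    (hd : ((d + 1 : ℕ) : WithBot ℕ∞) ≤ ringKrullDim (MvPolynomial σ K ⧸ P)) :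
    ∃ (c : K) (l : LTSeries (PrimeSpectrum (MvPolynomial σ K))), l.length = d ∧
      ∀ i, P ≤ (l i).asIdeal ∧ h ∉ (l i).asIdeal ∧ X j - C c ∈ (l i).asIdeal := by
  let A := MvPolynomial σ K ⧸ P
  obtain ⟨t, ht⟩ := exists_isTranscendenceBasis_X P
  let h' : A := Ideal.Quotient.mk P h
  have hh' : h' ≠ 0 := fun h0 => hh (Ideal.Quotient.eq_zero_iff_mem.1 h0)
  let R := Localization.Away h'
  have hR : ringKrullDim R = ringKrullDim A := ringKrullDim_localizationAway ht hh'
  have : Algebra.FiniteType A R := IsLocalization.finiteType_of_monoid_fg (Submonoid.powers h') _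
  have : Algebra.FiniteType K R := Algebra.FiniteType.trans inferInstance this
  have : IsNoetherianRing R := Algebra.FiniteType.isNoetherianRing K R
  -- A closed point of height greater than `d` off the hypersurface `h = 0`. The constant `c` will
  -- be the value of `X j` there, so that the hyperplane passes through the point; one equation
  -- lowers the dimension there by at most one.
  have hm : ∃ m : Ideal R, m.IsMaximal ∧ (d : ℕ∞) < m.height := by
    by_contra! hcon
    have := (ringKrullDim_le_iff_isMaximal_height_le (R := R) d).2
      fun m hm => by exact_mod_cast hcon m hm
    have := hd.trans (hR ▸ this)
    norm_cast at this
    omega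
  obtain ⟨m, hmax, hmd⟩ := hm
  obtain ⟨c, hc⟩ :=
    exists_sub_algebraMap_mem (K := K) m (algebraMap A R (Ideal.Quotient.mk P (X j)))
  set r : R := algebraMap A R (Ideal.Quotient.mk P (X j)) - algebraMap K R c
  have h1 := Ideal.height_le_ringKrullDim_quotient_add_one hc
  have h2 : (d : WithBot ℕ∞) ≤ ringKrullDim (R ⧸ Ideal.span {r}) := by
    have h3 : ((d + 1 : ℕ) : WithBot ℕ∞) ≤ m.height := by
      have := Order.add_one_le_of_lt hmd
      exact_mod_cast this
    have h4 := h3.trans h1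
    generalize ringKrullDim (R ⧸ Ideal.span {r}) = e at h4
    push_cast at h4
    cases e with
    | bot => simp at h4
    | coe e =>
      cases e with
      | top => exact WithBot.coe_le_coe.2 le_top
      | coe e =>
        norm_cast at h4 ⊢
        omega
  obtain ⟨l, hl⟩ := Order.le_krullDim_iff.1 h2
  let f : MvPolynomial σ K →+* R := (algebraMap A R).comp (Ideal.Quotient.mk P)
  have hf : Function.Injective (PrimeSpectrum.comap f) := by
    rw [PrimeSpectrum.comap_comp]
    exact (PrimeSpectrum.comap_injective_of_surjective _ Ideal.Quotient.mk_surjective).comp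
      (PrimeSpectrum.localization_comap_injective R (Submonoid.powers h'))
  have hq := PrimeSpectrum.comap_injective_of_surjective (Ideal.Quotient.mk (Ideal.span {r}))
    Ideal.Quotient.mk_surjective
  have hmono : StrictMono fun p : PrimeSpectrum (R ⧸ Ideal.span {r}) =>
      PrimeSpectrum.comap f (PrimeSpectrum.comap (Ideal.Quotient.mk (Ideal.span {r})) p) :=
    Monotone.strictMono_of_injective (fun p q hpq => Ideal.comap_mono (Ideal.comap_mono hpq))
      (hf.comp hq)
  refine ⟨c, l.map _ hmono, by simpa using hl, fun i => ?_⟩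
  have hmem : ∀ p, p ∈ ((l.map _ hmono) i).asIdeal ↔
      Ideal.Quotient.mk (Ideal.span {r}) (f p) ∈ (l i).asIdeal := fun p => Iff.rfl
  refine ⟨fun p hp => ?_, fun hmem_h => ?_, ?_⟩
  · rw [hmem]
    simp [f, Ideal.Quotient.eq_zero_iff_mem.2 hp]
  · rw [hmem] at hmem_h
    have hu : IsUnit (f h) := IsLocalization.Away.algebraMap_isUnit (S := R) h'
    exact (l i).2.ne_top (Ideal.eq_top_of_isUnit_mem _ hmem_h (hu.map _))
  · rw [hmem]
    have : f (X j - C c) = r := by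
      have : f (C c) = algebraMap K R c := by
        simp only [f, RingHom.comp_apply]
        rw [IsScalarTower.algebraMap_apply K A R]
        rfl
      rw [map_sub, this]
      rfl
    rw [this, Ideal.Quotient.eq_zero_iff_mem.2 (Ideal.mem_span_singleton_self r)]
    exact Ideal.zero_mem _

/-! ### Zariski closed sets and vanishing ideals -/

theorem mem_vanishingIdeal {K : Type*} [Field K] {ι : Type*} {S : Set (ι → K)}
    {p : MvPolynomial ι K} : p ∈ vanishingIdeal K S ↔ ∀ v ∈ S, eval v p = 0 := by
  simp [mem_vanishingIdeal_iff]

theorem eval_eq_zero_of_mem {K : Type*} [Field K] {ι : Type*} {S : Set (ι → K)}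
    {p : MvPolynomial ι K} (hp : p ∈ vanishingIdeal K S) {v : ι → K} (hv : v ∈ S) :
    eval v p = 0 :=
  mem_vanishingIdeal.1 hp v hv

theorem eval_aeval {K : Type*} [Field K] {ι τ : Type*} (t : τ → K) (f : ι → MvPolynomial τ K)
    (p : MvPolynomial ι K) : eval t (aeval f p) = eval (fun i => eval t (f i)) p := by
  change (aeval t : MvPolynomial τ K →ₐ[K] K) (aeval f p) = aeval (fun i => eval t (f i)) p
  rw [← AlgHom.comp_apply, comp_aeval]
  rfl

theorem isClosed_zariski {K : Type*} [Field K] {ι : Type*} {Z : Set (ι → K)} :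
    @IsClosed _ (zariski K ι) Z ↔
      ∃ S : Set (MvPolynomial ι K), Z = {v | ∀ p ∈ S, eval v p = 0} := by
  let := zariski K ι
  rw [← isOpen_compl_iff]
  change Zᶜᶜ ∈ _ ↔ _
  rw [compl_compl]
  rfl

theorem isClosed_induced_zariski {K : Type*} [Field K] {ι E : Type*} {g : E → ι → K} {Z : Set E} :
    @IsClosed _ (TopologicalSpace.induced g (zariski K ι)) Z ↔
      ∃ S : Set (MvPolynomial ι K), ∀ e, e ∈ Z ↔ ∀ p ∈ S, eval (g e) p = 0 := by
  let := zariski K ι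
  let := TopologicalSpace.induced g (zariski K ι)
  rw [isClosed_induced_iff]
  constructor
  · rintro ⟨t, ht, rfl⟩
    obtain ⟨S, rfl⟩ := isClosed_zariski.1 ht
    exact ⟨S, fun e => Iff.rfl⟩
  · rintro ⟨S, hS⟩
    refine ⟨_, isClosed_zariski.2 ⟨S, rfl⟩, ?_⟩
    ext e
    exact (hS e).symm

theorem isClosed_coinduced_zariski {K : Type*} [Field K] {ι E Q : Type*} {f : E → Q}
    {g : E → ι → K} {Z : Set Q} :
    @IsClosed _ (TopologicalSpace.coinduced f (TopologicalSpace.induced g (zariski K ι))) Z ↔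
      ∃ S : Set (MvPolynomial ι K), ∀ e, f e ∈ Z ↔ ∀ p ∈ S, eval (g e) p = 0 := by
  rw [isClosed_coinduced, isClosed_induced_zariski]
  rfl

/-- Hilbert's basis theorem: closed sets embed in the ideals, with the order reversed. -/
theorem noetherianSpace_zariski (K : Type*) [Field K] (ι : Type*) [Finite ι] :
    @TopologicalSpace.NoetherianSpace (ι → K) (zariski K ι) := by
  let := zariski K ι
  refine ((TopologicalSpace.noetherianSpace_TFAE (ι → K)).out 0 1).2 ?_
  have hanti : StrictAnti fun Z : TopologicalSpace.Closeds (ι → K) =>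
      vanishingIdeal K (Z : Set (ι → K)) := by
    refine Antitone.strictAnti_of_injective (fun Z Z' h => vanishingIdeal_anti_mono h) ?_
    intro Z Z' h
    have key : ∀ Z : TopologicalSpace.Closeds (ι → K),
        (Z : Set (ι → K)) = {v | ∀ p ∈ vanishingIdeal K (Z : Set (ι → K)), eval v p = 0} := by
      intro Z
      obtain ⟨S, hS⟩ := isClosed_zariski.1 Z.2
      refine Set.Subset.antisymm (fun v hv p hp => eval_eq_zero_of_mem hp hv) fun v hv => ?_
      change v ∈ Z.1
      rw [hS]
      intro p hp
      refine hv p (mem_vanishingIdeal.2 fun w hw => ?_)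
      change w ∈ Z.1 at hw
      rw [hS] at hw
      exact hw p hp
    refine SetLike.coe_injective ?_
    rw [key Z, key Z']
    exact congrArg (fun I : Ideal (MvPolynomial ι K) => {v | ∀ p ∈ I, eval v p = 0}) h
  exact ⟨StrictAnti.wellFoundedLT hanti |>.wf⟩

theorem noetherianSpace_coinduced {K : Type*} [Field K] {ι E Q : Type*} [Finite ι] {f : E → Q}
    (hf : Function.Surjective f) (g : E → ι → K) :
    @TopologicalSpace.NoetherianSpace Q
      (TopologicalSpace.coinduced f (TopologicalSpace.induced g (zariski K ι))) := by
  let := zariski K ι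
  let := TopologicalSpace.induced g (zariski K ι)
  let := TopologicalSpace.coinduced f (TopologicalSpace.induced g (zariski K ι))
  have := noetherianSpace_zariski K ι
  have : TopologicalSpace.NoetherianSpace E :=
    Topology.IsInducing.noetherianSpace (i := g) ⟨rfl⟩
  exact TopologicalSpace.noetherianSpace_of_surjective f continuous_coinduced_rng hf

instance BiProjSpace.instNoetherianSpace (K : Type*) [Field K] (M N : ℕ) :
    TopologicalSpace.NoetherianSpace (BiProjSpace K M N) := by
  refine noetherianSpace_coinduced ?_ _
  rintro ⟨x, y⟩
  refine ⟨⟨(x.rep, y.rep), x.rep_nonzero, y.rep_nonzero⟩, ?_⟩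
  exact Prod.ext x.mk_rep y.mk_rep

/-! ### Quotients by tori -/

theorem eval_scale {K : Type*} [Field K] {ι : Type*} (c v : ι → K) (p : MvPolynomial ι K) :
    eval (fun i => c i * v i) p = eval v (aeval (fun i => C (c i) * X i) p) := by
  rw [eval_aeval]
  simp

/-- A polynomial that vanishes where a non-zero polynomial does not vanish is zero. -/
theorem eq_zero_of_forall_eval_ne_zero {K : Type*} [Field K] [Infinite K] {ι : Type*}
    {p h : MvPolynomial ι K} (hh : h ≠ 0) (hp : ∀ v, eval v h ≠ 0 → eval v p = 0) : p = 0 := by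
  have : h * p = 0 := MvPolynomial.funext fun v => by
    by_cases hv : eval v h = 0
    · simp [hv]
    · simp [hp v hv]
  exact (mul_eq_zero.1 this).resolve_left hh

/-- The preimage of an irreducible set under a quotient map by a torus has a prime vanishing
ideal. -/
theorem isPrime_vanishingIdeal_of_torus {K : Type*} [Field K] [Infinite K] {ι τ E Q : Type*}
    [Fintype τ] (r : ι → τ) {f : E → Q} {g : E → ι → K}
    (hfib : ∀ e e', f e' = f e ↔
      ∃ t : τ → K, (∀ a, t a ≠ 0) ∧ g e' = fun i => t (r i) * g e i)
    (hact : ∀ e, ∀ t : τ → K, (∀ a, t a ≠ 0) → ∃ e', g e' = fun i => t (r i) * g e i)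
    (hsurj : Function.Surjective f) {W : Set Q}
    (hW : @IsIrreducible Q
      (TopologicalSpace.coinduced f (TopologicalSpace.induced g (zariski K ι))) W) :
    (vanishingIdeal K (g '' (f ⁻¹' W))).IsPrime := by
  let := TopologicalSpace.coinduced f (TopologicalSpace.induced g (zariski K ι))
  obtain ⟨⟨w, hw⟩, hirr⟩ := hW
  rw [isPreirreducible_iff_isClosed_union_isClosed] at hirr
  have hmem : ∀ p, p ∈ vanishingIdeal K (g '' (f ⁻¹' W)) ↔ ∀ e, f e ∈ W → eval (g e) p = 0 := by
    intro p
    rw [mem_vanishingIdeal]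
    exact ⟨fun h e he => h _ ⟨e, he, rfl⟩, by rintro h _ ⟨e, he, rfl⟩; exact h e he⟩
  -- `Z p` consists of the points over whose whole fibre `p` vanishes. It is closed even when `p` is
  -- not homogeneous, since all torus translates of `p` cut it out.
  let Z : MvPolynomial ι K → Set Q := fun p => {x | ∀ e, f e = x → eval (g e) p = 0}
  have hZ : ∀ p e, f e ∈ Z p ↔ ∀ t : τ → K, (∀ a, t a ≠ 0) →
      eval (fun i => t (r i) * g e i) p = 0 := by
    intro p e
    constructor
    · intro h t ht
      obtain ⟨e', he'⟩ := hact e t ht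
      rw [← he']
      exact h e' ((hfib e e').2 ⟨t, ht, he'⟩)
    · intro h e' he'
      obtain ⟨t, ht, hte⟩ := (hfib e e').1 he'
      rw [hte]
      exact h t ht
  have hclosed : ∀ p, IsClosed (Z p) := by
    intro p
    refine isClosed_coinduced_zariski.2
      ⟨{q | ∃ t : τ → K, (∀ a, t a ≠ 0) ∧ q = aeval (fun i => C (t (r i)) * X i) p}, fun e => ?_⟩
    rw [hZ]
    constructor
    · rintro h q ⟨t, ht, rfl⟩
      rw [← eval_scale]
      exact h t ht
    · intro h t ht
      rw [eval_scale (fun i => t (r i))]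
      exact h _ ⟨t, ht, rfl⟩
  have hsub : ∀ p, W ⊆ Z p ↔ p ∈ vanishingIdeal K (g '' (f ⁻¹' W)) := by
    intro p
    rw [hmem]
    exact ⟨fun h e he => h he e rfl, fun h x hx e he => h e (he ▸ hx)⟩
  constructor
  · rw [Ideal.ne_top_iff_one, hmem]
    intro h
    obtain ⟨e, rfl⟩ := hsurj w
    simpa using h e hw
  · intro p q hpq
    rw [← hsub, ← hsub]
    refine hirr _ _ (hclosed p) (hclosed q) fun x hx => ?_
    obtain ⟨e, rfl⟩ := hsurj x
    rw [Set.mem_union, hZ, hZ]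
    -- `φ` restricts polynomials to the torus orbit of `e`. As `K[t]` is a domain, one of `p` and
    -- `q` vanishes on the whole orbit, so `W` is covered by `Z p` and `Z q`.
    let φ : MvPolynomial ι K →ₐ[K] MvPolynomial τ K := aeval fun i => X (r i) * C (g e i)
    have hφ : ∀ p t, eval t (φ p) = eval (fun i => t (r i) * g e i) p := by
      intro p t
      rw [eval_aeval]
      simp
    have h0 : φ p * φ q = 0 := by
      refine eq_zero_of_forall_eval_ne_zero (h := ∏ a : τ, X a)
        (Finset.prod_ne_zero_iff.2 fun a _ => X_ne_zero a) fun t ht => ?_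
      have ht' : ∀ a, t a ≠ 0 := by
        simpa [Finset.prod_eq_zero_iff] using ht
      obtain ⟨e', he'⟩ := hact e t ht'
      have he'W : f e' ∈ W := by rwa [(hfib e e').2 ⟨t, ht', he'⟩]
      rw [← map_mul, hφ, ← he']
      exact (hmem _).1 hpq e' he'W
    rcases mul_eq_zero.1 h0 with h | h
    · left
      intro t _
      rw [← hφ, h, map_zero]
    · right
      intro t _
      rw [← hφ, h, map_zero]

theorem mk_eq_mk_iff_exists_ne_zero {K V : Type*} [Field K] [AddCommGroup V] [Module K V]
    {v w : V} (hv : v ≠ 0) (hw : w ≠ 0) :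
    Projectivization.mk K v hv = Projectivization.mk K w hw ↔ ∃ a : K, a ≠ 0 ∧ v = a • w := by
  rw [Projectivization.mk_eq_mk_iff']
  constructor
  · rintro ⟨a, rfl⟩
    exact ⟨a, fun h => hv (by simp [h]), rfl⟩
  · rintro ⟨a, -, rfl⟩
    exact ⟨a, rfl⟩

theorem isPrime_vanishingIdeal_cone {K : Type*} [Field K] [Infinite K] {N : ℕ}
    {Z : Set (ProjSpace K N)} (hZ : IsIrreducible Z) : (vanishingIdeal K (cone Z)).IsPrime := by
  have hcone : cone Z = (fun v : {v : Fin (N + 1) → K // v ≠ 0} => v.1) ''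
      ((fun v : {v : Fin (N + 1) → K // v ≠ 0} => Projectivization.mk K v.1 v.2) ⁻¹' Z) := by
    ext v
    exact ⟨fun ⟨h, hv⟩ => ⟨⟨v, h⟩, hv, rfl⟩, by rintro ⟨⟨v, h⟩, hv, rfl⟩; exact ⟨h, hv⟩⟩
  rw [hcone]
  refine isPrime_vanishingIdeal_of_torus (τ := Unit) (fun _ => ()) ?_ ?_ ?_ hZ
  · rintro ⟨v, hv⟩ ⟨v', hv'⟩
    rw [mk_eq_mk_iff_exists_ne_zero hv' hv]
    constructor
    · rintro ⟨a, ha, h⟩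
      exact ⟨fun _ => a, fun _ => ha, h⟩
    · rintro ⟨t, ht, h⟩
      exact ⟨t (), ht (), h⟩
  · rintro ⟨v, hv⟩ t ht
    exact ⟨⟨t () • v, smul_ne_zero (ht ()) hv⟩, rfl⟩
  · intro x
    exact ⟨⟨x.rep, x.rep_nonzero⟩, x.mk_rep⟩

theorem isPrime_vanishingIdeal_bicone {K : Type*} [Field K] [Infinite K] {M N : ℕ}
    {Z : Set (BiProjSpace K M N)} (hZ : IsIrreducible Z) :
    (vanishingIdeal K (bicone Z)).IsPrime := by
  have hcone : bicone Z =
      (fun z : {z : (Fin (M + 1) → K) × (Fin (N + 1) → K) // z.1 ≠ 0 ∧ z.2 ≠ 0} =>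
        Sum.elim z.1.1 z.1.2) ''
      ((fun z : {z : (Fin (M + 1) → K) × (Fin (N + 1) → K) // z.1 ≠ 0 ∧ z.2 ≠ 0} =>
        ((Projectivization.mk K z.1.1 z.2.1, Projectivization.mk K z.1.2 z.2.2) :
          BiProjSpace K M N)) ⁻¹' Z) := by
    ext z
    constructor
    · rintro ⟨u, v, hu, hv, rfl, h⟩
      exact ⟨⟨(u, v), hu, hv⟩, h, rfl⟩
    · rintro ⟨⟨⟨u, v⟩, hu, hv⟩, h, rfl⟩
      exact ⟨u, v, hu, hv, rfl, h⟩
  rw [hcone]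
  refine isPrime_vanishingIdeal_of_torus (τ := Bool)
    (Sum.elim (fun _ => true) (fun _ => false)) ?_ ?_ ?_ hZ
  · rintro ⟨⟨u, v⟩, hu, hv⟩ ⟨⟨u', v'⟩, hu', hv'⟩
    dsimp only
    rw [Prod.ext_iff, mk_eq_mk_iff_exists_ne_zero hu' hu, mk_eq_mk_iff_exists_ne_zero hv' hv]
    constructor
    · rintro ⟨⟨a, ha, rfl⟩, b, hb, rfl⟩
      refine ⟨fun c => if c then a else b, fun c => by cases c <;> simpa, ?_⟩
      ext (i | i) <;> simp
    · rintro ⟨t, ht, h⟩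
      refine ⟨⟨t true, ht _, ?_⟩, t false, ht _, ?_⟩
      · ext i
        simpa using congrFun h (Sum.inl i)
      · ext i
        simpa using congrFun h (Sum.inr i)
  · rintro ⟨⟨u, v⟩, hu, hv⟩ t ht
    refine ⟨⟨(t true • u, t false • v), smul_ne_zero (ht _) hu, smul_ne_zero (ht _) hv⟩, ?_⟩
    ext (i | i) <;> simp
  · rintro ⟨x, y⟩
    refine ⟨⟨(x.rep, y.rep), x.rep_nonzero, y.rep_nonzero⟩, ?_⟩
    exact Prod.ext x.mk_rep y.mk_rep

/-! ### Closed sets, cones and the dimension of subsets of projective space. -/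

theorem isClosed_projSpace_iff {K : Type*} [Field K] {N : ℕ} {Z : Set (ProjSpace K N)} :
    IsClosed Z ↔ ∃ S : Set (MvPolynomial (Fin (N + 1)) K), ∀ (v : Fin (N + 1) → K) (hv : v ≠ 0),
      Projectivization.mk K v hv ∈ Z ↔ ∀ p ∈ S, eval v p = 0 :=
  isClosed_coinduced_zariski.trans
    ⟨fun ⟨S, hS⟩ => ⟨S, fun v hv => hS ⟨v, hv⟩⟩, fun ⟨S, hS⟩ => ⟨S, fun v => hS v.1 v.2⟩⟩

theorem isClosed_grass_iff {K : Type*} [Field K] {N k : ℕ} {Z : Set (Grass K N k)} :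
    IsClosed Z ↔ ∃ S : Set (MvPolynomial (Fin (k + 1) × Fin (N + 1)) K), ∀ A : Frame K N k,
      A.span ∈ Z ↔ ∀ p ∈ S, eval (entries A.1) p = 0 :=
  isClosed_coinduced_zariski

theorem smul_mem_cone {K : Type*} [Field K] {N : ℕ} {Z : Set (ProjSpace K N)}
    {v : Fin (N + 1) → K} (hv : v ∈ cone Z) {t : K} (ht : t ≠ 0) : t • v ∈ cone Z := by
  obtain ⟨h, hv⟩ := hv
  refine ⟨smul_ne_zero ht h, ?_⟩
  rwa [(mk_eq_mk_iff_exists_ne_zero (smul_ne_zero ht h) h).2 ⟨t, ht, rfl⟩]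

theorem rep_mem_cone {K : Type*} [Field K] {N : ℕ} {Z : Set (ProjSpace K N)}
    {x : ProjSpace K N} (hx : x ∈ Z) : x.rep ∈ cone Z :=
  ⟨x.rep_nonzero, by rwa [x.mk_rep]⟩

/-- A polynomial that vanishes on a non-empty cone without its vertex also vanishes at the
vertex. -/
theorem eval_zero_of_mem_vanishingIdeal_cone {K : Type*} [Field K] [Infinite K] {N : ℕ}
    {Z : Set (ProjSpace K N)} (hZ : Z.Nonempty) {p : MvPolynomial (Fin (N + 1)) K}
    (hp : p ∈ vanishingIdeal K (cone Z)) : eval 0 p = 0 := by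
  obtain ⟨x, hx⟩ := hZ
  let φ : MvPolynomial (Fin (N + 1)) K →ₐ[K] MvPolynomial Unit K :=
    aeval fun i => X () * C (x.rep i)
  have hφ : ∀ t, eval t (φ p) = eval (fun i => t () * x.rep i) p := by
    intro t
    rw [eval_aeval]
    simp
  have h0 : φ p = 0 := by
    refine eq_zero_of_forall_eval_ne_zero (h := X ()) (X_ne_zero ()) fun t ht => ?_
    rw [hφ]
    exact eval_eq_zero_of_mem hp (smul_mem_cone (rep_mem_cone hx) (by simpa using ht))
  have := hφ 0
  rw [h0, map_zero] at this
  rw [this]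
  congr 2
  ext i
  simp

/-- The homogeneous coordinate ring of a subset `Z` of `ℙ^N` has Krull dimension at least
`dim Z + 1`. -/
theorem topologicalKrullDim_add_one_le {K : Type*} [Field K] [Infinite K] {N : ℕ}
    {Z : Set (ProjSpace K N)} (hZ : Z.Nonempty) :
    topologicalKrullDim Z + 1 ≤
      ringKrullDim (MvPolynomial (Fin (N + 1)) K ⧸ vanishingIdeal K (cone Z)) := by
  let I : TopologicalSpace.IrreducibleCloseds Z → Ideal (MvPolynomial (Fin (N + 1)) K) :=
    fun Y => vanishingIdeal K (cone (Subtype.val '' Y.carrier))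
  have hirr : ∀ Y : TopologicalSpace.IrreducibleCloseds Z,
      IsIrreducible (Subtype.val '' Y.carrier) :=
    fun Y => Y.isIrreducible'.image _ continuous_subtype_val.continuousOn
  have hle : ∀ Y, vanishingIdeal K (cone Z) ≤ I Y := fun Y =>
    vanishingIdeal_anti_mono fun v ⟨h, y, _, hy⟩ => ⟨h, hy ▸ y.2⟩
  have hmono : ∀ Y Y', Y ≤ Y' → I Y' ≤ I Y := fun Y Y' h =>
    vanishingIdeal_anti_mono fun v ⟨hv, y, hy, hyv⟩ => ⟨hv, y, h hy, hyv⟩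
  have hle' : ∀ Y Y', I Y' ≤ I Y → Y ≤ Y' := by
    intro Y Y' h y hy
    obtain ⟨T, hT, hTY⟩ := isClosed_induced_iff.1 Y'.isClosed'
    obtain ⟨S, hS⟩ := isClosed_projSpace_iff.1 hT
    change y ∈ Y'.carrier
    rw [← hTY, Set.mem_preimage, ← y.1.mk_rep, hS]
    intro p hp
    have hpI : p ∈ I Y' := by
      refine mem_vanishingIdeal.2 ?_
      rintro v ⟨hv, z, hz, hzv⟩
      rw [← hTY, Set.mem_preimage, hzv, hS] at hz
      exact hz p hp
    exact eval_eq_zero_of_mem (h hpI) (rep_mem_cone ⟨y, hy, rfl⟩)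
  -- The ideal of the vertex lies strictly above every `I Y`, so it adds one link to each chain.
  -- This is the `+ 1`, modelled below by adjoining a bottom element that is sent to `m`.
  let m : Ideal (MvPolynomial (Fin (N + 1)) K) := vanishingIdeal K {(0 : Fin (N + 1) → K)}
  have hm : ∀ Y, I Y < m := by
    intro Y
    obtain ⟨y, hy⟩ := (hirr Y).nonempty
    refine lt_of_le_not_ge (fun p hp => mem_vanishingIdeal.2 ?_) fun hcon => ?_
    · rintro v rfl
      exact eval_zero_of_mem_vanishingIdeal_cone ⟨y, hy⟩ hp
    · obtain ⟨i, hi⟩ := Function.ne_iff.1 y.rep_nonzero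
      have : (X i : MvPolynomial (Fin (N + 1)) K) ∈ m := mem_vanishingIdeal.2 (by simp)
      exact hi (by simpa using eval_eq_zero_of_mem (hcon this) (rep_mem_cone hy))
  have hmle : vanishingIdeal K (cone Z) ≤ m := fun p hp => mem_vanishingIdeal.2 (by
    rintro v rfl
    exact eval_zero_of_mem_vanishingIdeal_cone hZ hp)
  have hmprime : m.IsPrime := by
    refine ⟨?_, ?_⟩
    · rw [Ideal.ne_top_iff_one, mem_vanishingIdeal]
      simp
    · intro p q
      simp [m]
  obtain ⟨z, hz⟩ := hZ
  have : Nonempty (TopologicalSpace.IrreducibleCloseds Z) :=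
    ⟨⟨closure {⟨z, hz⟩}, isIrreducible_singleton.closure, isClosed_closure⟩⟩
  rw [topologicalKrullDim, ← Order.krullDim_withBot, ringKrullDim_quotient,
    ← Order.krullDim_orderDual (α := PrimeSpectrum.zeroLocus _)]
  let F : WithBot (TopologicalSpace.IrreducibleCloseds Z) →
      (PrimeSpectrum.zeroLocus
        (vanishingIdeal K (cone Z) : Set (MvPolynomial (Fin (N + 1)) K)))ᵒᵈ := fun Y =>
    OrderDual.toDual (WithBot.recBotCoe ⟨⟨m, hmprime⟩, hmle⟩
      (fun Y => ⟨⟨I Y, isPrime_vanishingIdeal_cone (hirr Y)⟩, hle Y⟩) Y)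
  refine Order.krullDim_le_of_strictMono F fun Y Y' h => ?_
  cases Y' with
  | bot => exact absurd h (by simp)
  | coe Y' =>
    cases Y with
    | bot => exact hm Y'
    | coe Y =>
      have hlt : Y < Y' := WithBot.coe_lt_coe.1 h
      exact lt_of_le_not_ge (hmono _ _ hlt.le) fun hcon => hlt.not_ge (hle' _ _ hcon)

/-! ### Zariski tangent spaces -/

/-- The restriction of a polynomial to the parametrized line `t ↦ z + t w`. -/
def lineRestrict {K : Type*} [Field K] {ι : Type*} (z w : ι → K) :
    MvPolynomial ι K →ₐ[K] Polynomial K :=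
  aeval fun i => Polynomial.C (z i) + Polynomial.C (w i) * Polynomial.X

theorem eval_lineRestrict {K : Type*} [Field K] {ι : Type*} (z w : ι → K) (t : K)
    (p : MvPolynomial ι K) : (lineRestrict z w p).eval t = eval (fun i => z i + w i * t) p := by
  change (Polynomial.aeval t) (lineRestrict z w p) = aeval (fun i => z i + w i * t) p
  rw [lineRestrict, ← AlgHom.comp_apply, comp_aeval]
  simp

theorem derivative_lineRestrict {K : Type*} [Field K] {ι : Type*} [Fintype ι] (z w : ι → K)
    (p : MvPolynomial ι K) :
    (Polynomial.derivative (lineRestrict z w p)).eval 0 = ∑ i, w i * eval z (pderiv i p) := by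
  classical
  induction p using MvPolynomial.induction_on with
  | C a => simp [lineRestrict]
  | add p q hp hq => simp [hp, hq, mul_add, Finset.sum_add_distrib]
  | mul_X p n hp =>
    have h1 : ∀ i, w i * eval z (pderiv i (p * X n)) =
        w i * eval z p * (if i = n then 1 else 0) + z n * (w i * eval z (pderiv i p)) := by
      intro i
      rw [Derivation.leibniz, pderiv_X, Pi.single_apply]
      split_ifs with h h' h'
      · simp; ring
      · exact absurd h.symm h'
      · exact absurd h'.symm h
      · simp; ring
    simp_rw [h1]
    rw [Finset.sum_add_distrib, ← Finset.mul_sum, ← hp, map_mul, Polynomial.derivative_mul,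
      Polynomial.eval_add, Polynomial.eval_mul, Polynomial.eval_mul, eval_lineRestrict,
      eval_lineRestrict]
    have hX : Polynomial.derivative (lineRestrict z w (X n)) = Polynomial.C (w n) := by
      simp [lineRestrict]
    rw [hX]
    simp [mul_comm, add_comm]

/-- Tangency read on lines: the behaviour under substitutions reduces to identities between
`lineRestrict`s. -/
theorem mem_zariskiTangent_iff {K : Type*} [Field K] {ι : Type*} [Fintype ι] {S : Set (ι → K)}
    {z w : ι → K} : w ∈ zariskiTangent S z ↔ ∀ p ∈ vanishingIdeal K S,
      (Polynomial.derivative (lineRestrict z w p)).eval 0 = 0 := by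
  simp_rw [derivative_lineRestrict, mem_vanishingIdeal]
  rfl

theorem zariskiTangent_mono {K : Type*} [Field K] {ι : Type*} [Fintype ι] {S S' : Set (ι → K)}
    (h : S ⊆ S') (z : ι → K) : zariskiTangent S z ≤ zariskiTangent S' z :=
  fun _ hw p hp => hw p fun c hc => hp c (h hc)

theorem mem_zariskiTangent_of_scale {K : Type*} [Field K] {ι : Type*} [Fintype ι]
    {S : Set (ι → K)} (c : ι → K) (hc : ∀ z ∈ S, (fun i => c i * z i) ∈ S) {z w : ι → K}
    (hw : w ∈ zariskiTangent S z) :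
    (fun i => c i * w i) ∈ zariskiTangent S fun i => c i * z i := by
  rw [mem_zariskiTangent_iff] at hw ⊢
  intro p hp
  have h : lineRestrict (fun i => c i * z i) (fun i => c i * w i) p =
      lineRestrict z w (aeval (fun i => C (c i) * X i) p) := by
    simp only [lineRestrict]
    rw [← AlgHom.comp_apply, comp_aeval]
    congr 2
    ext1 i
    simp [mul_add, mul_assoc]
  rw [h]
  refine hw _ (mem_vanishingIdeal.2 fun v hv => ?_)
  rw [← eval_scale]
  exact eval_eq_zero_of_mem hp (hc v hv)

theorem comp_mem_zariskiTangent {K : Type*} [Field K] {ι τ : Type*} [Fintype ι] [Fintype τ]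
    (r : τ → ι) {S : Set (ι → K)} {S' : Set (τ → K)} (hr : ∀ z ∈ S, z ∘ r ∈ S') {z w : ι → K}
    (hw : w ∈ zariskiTangent S z) : w ∘ r ∈ zariskiTangent S' (z ∘ r) := by
  rw [mem_zariskiTangent_iff] at hw ⊢
  intro p hp
  have h : lineRestrict (z ∘ r) (w ∘ r) p = lineRestrict z w (rename r p) := by
    simp [lineRestrict, aeval_rename]
    rfl
  rw [h]
  refine hw _ (mem_vanishingIdeal.2 fun v hv => ?_)
  rw [eval_rename]
  exact eval_eq_zero_of_mem hp (hr v hv)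

/-- A polynomial with infinitely many zeros on a line vanishes along it, and so does its derivative.
-/
theorem mem_zariskiTangent_of_infinite {K : Type*} [Field K] {ι : Type*} [Fintype ι]
    {S : Set (ι → K)} {z w : ι → K} (h : {t : K | (fun i => z i + w i * t) ∈ S}.Infinite) :
    w ∈ zariskiTangent S z := by
  rw [mem_zariskiTangent_iff]
  intro p hp
  have : lineRestrict z w p = 0 :=
    Polynomial.eq_zero_of_infinite_isRoot _ (h.mono fun t ht => by
      change (lineRestrict z w p).eval t = 0
      rw [eval_lineRestrict]
      exact eval_eq_zero_of_mem hp ht)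
  simp [this]

theorem smul_mem_zariskiTangent_cone {K : Type*} [Field K] {N : ℕ} {Z : Set (ProjSpace K N)}
    {z w : Fin (N + 1) → K} {t : K} (ht : t ≠ 0) (hw : w ∈ zariskiTangent (cone Z) z) :
    w ∈ zariskiTangent (cone Z) (t • z) := by
  have h := mem_zariskiTangent_of_scale (fun _ => t) (fun z hz => smul_mem_cone hz ht) hw
  have h' := (zariskiTangent (cone Z) (t • z)).smul_mem t⁻¹ h
  convert h' using 1
  ext i
  simp [ht]

theorem mk_mem_bicone {K : Type*} [Field K] {M N : ℕ} {Z : Set (BiProjSpace K M N)}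
    {u : Fin (M + 1) → K} {v : Fin (N + 1) → K} :
    Sum.elim u v ∈ bicone Z ↔ ∃ (hu : u ≠ 0) (hv : v ≠ 0),
      ((Projectivization.mk K u hu, Projectivization.mk K v hv) : BiProjSpace K M N) ∈ Z := by
  constructor
  · rintro ⟨u', v', hu, hv, h, hZ⟩
    obtain rfl : u = u' := funext fun i => by simpa using congrFun h (Sum.inl i)
    obtain rfl : v = v' := funext fun i => by simpa using congrFun h (Sum.inr i)
    exact ⟨hu, hv, hZ⟩
  · rintro ⟨hu, hv, h⟩
    exact ⟨u, v, hu, hv, rfl, h⟩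

theorem smul_mem_bicone {K : Type*} [Field K] {M N : ℕ} {Z : Set (BiProjSpace K M N)}
    {s t : K} (hs : s ≠ 0) (ht : t ≠ 0) {z : Fin (M + 1) ⊕ Fin (N + 1) → K} (hz : z ∈ bicone Z) :
    (fun i => Sum.elim (fun _ => s) (fun _ => t) i * z i) ∈ bicone Z := by
  obtain ⟨u, v, hu, hv, rfl, h⟩ := hz
  refine ⟨s • u, t • v, smul_ne_zero hs hu, smul_ne_zero ht hv, ?_, ?_⟩
  · ext (i | i) <;> simp
  · rwa [(mk_eq_mk_iff_exists_ne_zero (smul_ne_zero hs hu) hu).2 ⟨s, hs, rfl⟩,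
      (mk_eq_mk_iff_exists_ne_zero (smul_ne_zero ht hv) hv).2 ⟨t, ht, rfl⟩]

/-! ### Local frames of a regular family of linear spaces -/

theorem contains_mk_iff {K : Type*} [Field K] {N k : ℕ} {L : Grass K N k} {v : Fin (N + 1) → K}
    (hv : v ≠ 0) : L.Contains (Projectivization.mk K v hv) ↔ v ∈ L.1 := by
  rw [Grass.Contains, Projectivization.submodule_mk, Submodule.span_singleton_le_iff_mem]

theorem exists_matrix_mul_eq_one {K : Type*} [Field K] {m n : Type*} [Fintype m] [Fintype n]
    [DecidableEq m] [DecidableEq n] {A : Matrix m n K} (hA : LinearIndependent K A.row) :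
    ∃ c : Matrix n m K, A * c = 1 := by
  rw [← Matrix.vecMul_injective_iff] at hA
  obtain ⟨f, hf⟩ := LinearMap.exists_leftInverse_of_injective (Matrix.vecMulLinear A)
    (LinearMap.ker_eq_bot.2 hA)
  refine ⟨(LinearMap.toMatrix' f).transpose, ?_⟩
  ext i j
  have := congrFun (LinearMap.congr_fun hf (Pi.single i 1)) j
  simp only [LinearMap.comp_apply, Matrix.vecMulLinear_apply, Matrix.single_one_vecMul,
    LinearMap.id_apply] at this
  rw [Matrix.one_apply, Matrix.mul_apply]
  rw [← LinearMap.toMatrix'_mulVec] at this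
  simp only [Matrix.mulVec, dotProduct, Matrix.transpose_apply] at this ⊢
  rw [Pi.single_apply] at this
  simp only [eq_comm (a := j)] at this
  rw [← this]
  exact Finset.sum_congr rfl fun l _ => mul_comm _ _

theorem eval_smul_of_isHomogeneous {K : Type*} [Field K] {ι : Type*} {p : MvPolynomial ι K} {d : ℕ}
    (hp : p.IsHomogeneous d) (a : K) (u : ι → K) : eval (a • u) p = a ^ d * eval u p := by
  rw [eval_eq, eval_eq, Finset.mul_sum]
  refine Finset.sum_congr rfl fun m hm => ?_
  have hd : ∑ i ∈ m.support, m i = d := by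
    rw [← hp (mem_support_iff.1 hm), Finsupp.weight_apply, Finsupp.sum]
    simp
  simp only [Pi.smul_apply, smul_eq_mul, mul_pow, Finset.prod_mul_distrib,
    Finset.prod_pow_eq_pow_sum, hd]
  ring

theorem linearIndependent_of_isUnit_det_mul {K : Type*} [Field K] {m n : Type*} [Fintype m]
    [Fintype n] [DecidableEq m] {A : Matrix m n K} {c : Matrix n m K} (h : (A * c).det ≠ 0) :
    LinearIndependent K A.row := by
  rw [← Matrix.vecMul_injective_iff]
  have h' : Function.Injective fun a : m → K => Matrix.vecMul a (A * c) :=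
    Matrix.vecMul_injective_iff.2 (Matrix.linearIndependent_rows_iff_isUnit.2
      ((Matrix.isUnit_iff_isUnit_det _).2 h.isUnit))
  intro a b hab
  refine h' ?_
  simp only [← Matrix.vecMul_vecMul]
  exact congrArg (fun v => Matrix.vecMul v c) hab

/-- A regular map to a Grassmannian is given near a point by a frame `A`. Where the polynomial `δ`
does not vanish, `A` is a frame, and the linear space is cut out by linear equations with
polynomial coefficients. -/
theorem IsRegularToGrass.exists_frame {K : Type*} [Field K] {M N k : ℕ} {Y : Set (ProjSpace K M)}
    {φ : Y → Grass K N k} (hφ : IsRegularToGrass φ) (y : Y) :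
    ∃ (A : Matrix (Fin (k + 1)) (Fin (N + 1)) (MvPolynomial (Fin (M + 1)) K))
      (Q : Matrix (Fin (N + 1)) (Fin (k + 1)) (MvPolynomial (Fin (M + 1)) K))
      (δ : MvPolynomial (Fin (M + 1)) K), eval y.1.rep δ ≠ 0 ∧
      ∀ (u : Fin (M + 1) → K) (hu : u ≠ 0) (hY : Projectivization.mk K u hu ∈ Y), eval u δ ≠ 0 →
        ∃ hA : LinearIndependent K (A.map (eval u)).row,
          φ ⟨_, hY⟩ = Frame.span ⟨_, hA⟩ ∧
          ∀ v ∈ (φ ⟨_, hY⟩).1,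
            eval u δ • v = Matrix.vecMul v (Q.map (eval u) * A.map (eval u)) := by
  obtain ⟨d, A, hhom, hind, hspan⟩ := hφ y
  -- `c` is a constant right inverse of the frame at `y`, and `δ = det (A c)` equals `1` there. For
  -- `v = a A` one has `v c adj(A c) A = δ v`, whence `Q = c adj(A c)`.
  obtain ⟨c, hc⟩ := exists_matrix_mul_eq_one (A := (Matrix.of A).map (eval y.1.rep)) hind
  let c' : Matrix (Fin (N + 1)) (Fin (k + 1)) (MvPolynomial (Fin (M + 1)) K) := c.map C
  have hc' : ∀ u, c'.map (eval u) = c := by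
    intro u
    ext i j
    simp [c']
  let B : Matrix (Fin (k + 1)) (Fin (k + 1)) (MvPolynomial (Fin (M + 1)) K) := Matrix.of A * c'
  have hB : ∀ u, B.map (eval u) = (Matrix.of A).map (eval u) * c := by
    intro u
    rw [← hc' u]
    exact Matrix.map_mul
  have hdet : ∀ u, eval u B.det = ((Matrix.of A).map (eval u) * c).det := by
    intro u
    rw [← hB, RingHom.map_det]
    rfl
  refine ⟨Matrix.of A, c' * B.adjugate, B.det, ?_, fun u hu hY hδ => ?_⟩
  · rw [hdet, hc]
    simp
  · have hA : LinearIndependent K ((Matrix.of A).map (eval u)).row := by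
      rw [hdet] at hδ
      exact linearIndependent_of_isUnit_det_mul hδ
    have hspanu : φ ⟨_, hY⟩ = Frame.span ⟨_, hA⟩ := by
      set z : Y := ⟨_, hY⟩
      have hz : Projectivization.mk K z.1.rep z.1.rep_nonzero = Projectivization.mk K u hu :=
        z.1.mk_rep
      -- Regularity is stated at the chosen representative. Passing from `u` to it multiplies all
      -- frame vectors by `a ^ d`, which does not change the span.
      obtain ⟨a, ha, hau⟩ := (mk_eq_mk_iff_exists_ne_zero z.1.rep_nonzero hu).1 hz
      have hev : (fun i j => eval z.1.rep (A i j)) =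
          fun i => a ^ d • ((Matrix.of A).map (eval u)).row i := by
        ext i j
        rw [hau]
        exact eval_smul_of_isHomogeneous (hhom i j) a u
      have hu' : IsUnit (a ^ d) := (pow_ne_zero d ha).isUnit
      have hind' : LinearIndependent K fun i j => eval z.1.rep (A i j) := by
        rw [hev]
        exact hA.units_smul fun _ => hu'.unit
      rw [hspan z hind']
      refine Subtype.ext ?_
      change Submodule.span K (Set.range fun i j => eval z.1.rep (A i j)) =
        Submodule.span K (Set.range ((Matrix.of A).map (eval u)).row)
      rw [hev]
      refine le_antisymm (Submodule.span_le.2 ?_) (Submodule.span_le.2 ?_)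
      · rintro _ ⟨i, rfl⟩
        exact Submodule.smul_mem _ _ (Submodule.subset_span ⟨i, rfl⟩)
      · rintro _ ⟨i, rfl⟩
        rw [SetLike.mem_coe, ← Submodule.smul_mem_iff _ (pow_ne_zero d ha)]
        exact Submodule.subset_span ⟨i, rfl⟩
    refine ⟨hA, hspanu, fun v hv => ?_⟩
    rw [hspanu] at hv
    change v ∈ Submodule.span K (Set.range ((Matrix.of A).map (eval u)).row) at hv
    rw [← range_vecMulLinear] at hv
    obtain ⟨a, rfl⟩ := hv
    rw [Matrix.vecMulLinear_apply]
    have hadj : (c' * B.adjugate).map (eval u) = c * (B.map (eval u)).adjugate := by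
      have h2 : B.adjugate.map (eval u) = (B.map (eval u)).adjugate :=
        RingHom.map_adjugate (eval u) B
      rw [← h2, ← hc' u]
      exact Matrix.map_mul
    rw [hadj, Matrix.vecMul_vecMul, ← Matrix.mul_assoc, ← Matrix.mul_assoc, ← hB,
      Matrix.mul_adjugate, Matrix.smul_mul, Matrix.one_mul, Matrix.vecMul_smul, hB, ← hdet]

/-! ### The tangent spaces of the incidence correspondence -/

/-- The projection of the tangent space of `K^(M+1) × K^(N+1)` to that of the second factor. -/
def toSpace (K : Type*) [Field K] (M N : ℕ) :
    (Fin (M + 1) ⊕ Fin (N + 1) → K) →ₗ[K] (Fin (N + 1) → K) :=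
  LinearMap.funLeft K K Sum.inr

/-- The projection of the tangent space of `K^(M+1) × K^(N+1)` to that of the first factor. -/
def toBase (K : Type*) [Field K] (M N : ℕ) :
    (Fin (M + 1) ⊕ Fin (N + 1) → K) →ₗ[K] (Fin (M + 1) → K) :=
  LinearMap.funLeft K K Sum.inl

theorem lineRestrict_rename_inl {K : Type*} [Field K] {ι τ : Type*} (u : ι → K) (v w : τ → K)
    (p : MvPolynomial ι K) :
    lineRestrict (Sum.elim u v) (Sum.elim 0 w) (rename Sum.inl p) = Polynomial.C (eval u p) := by
  rw [lineRestrict, aeval_rename]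
  have : (aeval ((fun i => Polynomial.C (Sum.elim u v i) +
      Polynomial.C (Sum.elim (0 : ι → K) w i) * Polynomial.X) ∘ Sum.inl) :
      MvPolynomial ι K →ₐ[K] Polynomial K) = Polynomial.CAlgHom.comp (aeval u) := by
    ext i
    simp
  rw [this]
  rfl

/-- Rank–nullity for `f` on `T`: the image lies in `E`, and `g` embeds the kernel in `L`. -/
theorem finrank_le_of_map_le {K V U U' : Type*} [Field K] [AddCommGroup V] [Module K V]
    [FiniteDimensional K V] [AddCommGroup U] [Module K U] [FiniteDimensional K U]
    [AddCommGroup U'] [Module K U'] [FiniteDimensional K U'] {T : Submodule K V}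
    {E : Submodule K U} {L : Submodule K U'} (f : V →ₗ[K] U) (g : V →ₗ[K] U')
    (hE : ∀ z ∈ T, f z ∈ E) (hL : ∀ z ∈ T, f z = 0 → g z ∈ L)
    (hfg : ∀ z, f z = 0 → g z = 0 → z = 0) : finrank K T ≤ finrank K E + finrank K L := by
  let f' := f ∘ₗ T.subtype
  let g' := (g ∘ₗ T.subtype) ∘ₗ (LinearMap.ker f').subtype
  have hrange : LinearMap.range f' ≤ E := by
    rintro _ ⟨z, rfl⟩
    exact hE _ z.2
  have hgL : LinearMap.range g' ≤ L := by
    rintro _ ⟨z, rfl⟩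
    exact hL _ z.1.2 z.2
  have hg : Function.Injective g' := by
    refine (injective_iff_map_eq_zero g').2 fun z hz => Subtype.ext (Subtype.ext ?_)
    exact hfg _ z.2 hz
  have h1 := LinearMap.finrank_range_add_finrank_ker f'
  have h2 := LinearMap.finrank_range_of_inj hg
  have h3 := Submodule.finrank_mono hrange
  have h4 := Submodule.finrank_mono hgL
  omega

/-- The rank hypothesis makes `ker χ` at least two-dimensional, and `f` embeds it in the kernel of
`g` on `T`. The `- 1` accounts for the line of the cone, which lies in `E`. -/
theorem finrank_map_add_two_le {K V U U' V' : Type*} [Field K] [AddCommGroup V] [Module K V]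
    [FiniteDimensional K V] [AddCommGroup U] [Module K U] [FiniteDimensional K U]
    [AddCommGroup U'] [Module K U'] [AddCommGroup V'] [Module K V'] {T : Submodule K V}
    {E : Submodule K U} (g : V →ₗ[K] U') (χ : E →ₗ[K] V') (f : U →ₗ[K] V)
    (hf : Function.Injective f) (hχ : ∀ e : E, χ e = 0 → f e ∈ T) (hgf : ∀ e, g (f e) = 0)
    (hrank : finrank K (LinearMap.range χ) < finrank K E - 1) :
    finrank K (T.map g) + 2 ≤ finrank K T := by
  let g' := g ∘ₗ T.subtype
  have hle : (LinearMap.ker χ).map (f ∘ₗ E.subtype) ≤ (LinearMap.ker g').map T.subtype := by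
    rintro _ ⟨e, he, rfl⟩
    exact ⟨⟨_, hχ e he⟩, hgf _, rfl⟩
  have h1 := LinearMap.finrank_range_add_finrank_ker g'
  have h2 := LinearMap.finrank_range_add_finrank_ker χ
  have h3 := Submodule.finrank_mono hle
  have hfE : Function.Injective (f ∘ₗ E.subtype) := fun e e' h => Subtype.ext (hf h)
  rw [← (Submodule.equivMapOfInjective _ hfE _).finrank_eq,
    ← (Submodule.equivMapOfInjective _ T.subtype_injective _).finrank_eq] at h3
  rw [LinearMap.range_comp, Submodule.range_subtype] at h1
  omega

namespace Desingularization

variable {K : Type*} [Field K] {N k : ℕ} {B : Set (Grass K N k)} (D : Desingularization B)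

theorem elim_mem_bicone_incidence {u : Fin (D.M + 1) → K} {v : Fin (N + 1) → K} :
    Sum.elim u v ∈ bicone D.incidence ↔ ∃ (hu : u ≠ 0) (_ : v ≠ 0)
      (h : Projectivization.mk K u hu ∈ D.carrier), v ∈ (D.toGrass ⟨_, h⟩).1 := by
  rw [mk_mem_bicone]
  constructor
  · rintro ⟨hu, hv, h, hc⟩
    exact ⟨hu, hv, h, (contains_mk_iff hv).1 hc⟩
  · rintro ⟨hu, hv, h, hc⟩
    exact ⟨hu, hv, h, (contains_mk_iff hv).2 hc⟩

theorem toGrass_mk_rep (b : D.carrier) (h : Projectivization.mk K b.1.rep b.1.rep_nonzero ∈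
    D.carrier) : D.toGrass ⟨_, h⟩ = D.toGrass b :=
  congrArg D.toGrass (Subtype.ext b.1.mk_rep)

/-- The local equations of `I` are linear in the space coordinates, so differentiating them in a
vertical direction `w` gives the equations of `Λ_b` evaluated at `w`. -/
theorem mem_of_elim_zero_mem_incidenceTangent {y : ProjSpace K D.M} (h : y ∈ D.carrier)
    {x : ProjSpace K N} {w : Fin (N + 1) → K}
    (hw : Sum.elim (0 : Fin (D.M + 1) → K) w ∈
      zariskiTangent (bicone D.incidence) (Sum.elim y.rep x.rep)) :
    w ∈ (D.toGrass ⟨y, h⟩).1 := by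
  obtain ⟨A, Q, δ, hδ, hA⟩ := D.regular.exists_frame ⟨y, h⟩
  have hb : Projectivization.mk K y.rep y.rep_nonzero ∈ D.carrier := by
    rw [y.mk_rep]; exact h
  have hev : ∀ u l j, eval u ((Q * A) l j) = (Q.map (eval u) * A.map (eval u)) l j := by
    intro u l j
    have : (Q * A).map (eval u) = Q.map (eval u) * A.map (eval u) := Matrix.map_mul
    rw [← this, Matrix.map_apply]
  -- The outer factor `δ` makes the equation hold on the whole bicone, also where the frame
  -- degenerates. In vertical directions it is a non-zero constant and cancels.
  let G : Fin (N + 1) → MvPolynomial (Fin (D.M + 1) ⊕ Fin (N + 1)) K := fun j =>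
    rename Sum.inl δ * (rename Sum.inl δ * X (Sum.inr j) -
      ∑ l, X (Sum.inr l) * rename Sum.inl ((Q * A) l j))
  have hG : ∀ j, G j ∈ vanishingIdeal K (bicone D.incidence) := by
    intro j
    refine mem_vanishingIdeal.2 ?_
    rintro _ ⟨u, v, hu, hv, rfl, hY, hc⟩
    simp only [G, map_mul, map_sub, map_sum, eval_rename, eval_X, Sum.elim_inr, Sum.elim_comp_inl]
    by_cases hδu : eval u δ = 0
    · rw [hδu, zero_mul]
    · obtain ⟨-, -, h3⟩ := hA u hu hY hδu
      have := congrFun (h3 v ((contains_mk_iff hv).1 hc)) j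
      rw [Pi.smul_apply, smul_eq_mul] at this
      rw [this]
      simp [Matrix.vecMul, dotProduct, hev]
  obtain ⟨hAind, hspan, -⟩ := hA y.rep y.rep_nonzero hb hδ
  have hw' : ∀ j, eval y.rep δ * w j =
      Matrix.vecMul w (Q.map (eval y.rep) * A.map (eval y.rep)) j := by
    intro j
    have hj := mem_zariskiTangent_iff.1 hw _ (hG j)
    simp only [G, map_mul, map_sub, map_sum, lineRestrict_rename_inl y.rep x.rep w] at hj
    simp only [lineRestrict, aeval_X, Sum.elim_inr] at hj
    rw [Polynomial.derivative_C_mul, Polynomial.eval_C_mul] at hj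
    have hj := (mul_eq_zero.1 hj).resolve_left hδ
    simp only [Polynomial.derivative_sub, Polynomial.derivative_sum, Polynomial.derivative_mul,
      Polynomial.derivative_C, Polynomial.derivative_add, Polynomial.derivative_X,
      Polynomial.eval_sub, Polynomial.eval_mul, Polynomial.eval_C, Polynomial.eval_finsetSum,
      zero_mul, mul_zero, mul_one, zero_add, add_zero, hev] at hj
    rw [sub_eq_zero.1 hj]
    rfl
  have hw2 : eval y.rep δ • w ∈ (D.toGrass ⟨y, h⟩).1 := by
    rw [← D.toGrass_mk_rep ⟨y, h⟩ hb, hspan]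
    change _ ∈ Submodule.span K (Set.range (A.map (eval y.rep)).row)
    rw [← range_vecMulLinear]
    refine ⟨Matrix.vecMul w (Q.map (eval y.rep)), ?_⟩
    rw [Matrix.vecMulLinear_apply, Matrix.vecMul_vecMul]
    exact funext fun j => (hw' j).symm
  exact (Submodule.smul_mem_iff _ hδ).1 hw2

/-- The line `x + t w` stays in `Λ_b` and meets the origin, which the bicone omits, for at most one
`t`. -/
theorem elim_zero_mem_incidenceTangent [Infinite K] {y : ProjSpace K D.M} (h : y ∈ D.carrier)
    {x : ProjSpace K N} (hq : (D.toGrass ⟨y, h⟩).Contains x) {w : Fin (N + 1) → K}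
    (hw : w ∈ (D.toGrass ⟨y, h⟩).1) :
    Sum.elim (0 : Fin (D.M + 1) → K) w ∈
      zariskiTangent (bicone D.incidence) (Sum.elim y.rep x.rep) := by
  have hb : Projectivization.mk K y.rep y.rep_nonzero ∈ D.carrier := by
    rw [y.mk_rep]; exact h
  have hx : x.rep ∈ (D.toGrass ⟨y, h⟩).1 := by
    rw [← contains_mk_iff x.rep_nonzero, x.mk_rep]; exact hq
  have hfin : {t : K | x.rep + t • w = 0}.Finite := by
    refine Set.Subsingleton.finite fun t ht s hs => ?_
    by_contra hts
    have h1 : (t - s) • w = 0 := by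
      rw [sub_smul, sub_eq_zero]
      exact add_left_cancel (ht.trans hs.symm)
    have hw0 := (smul_eq_zero.1 h1).resolve_left (sub_ne_zero.2 hts)
    refine x.rep_nonzero ?_
    simpa [hw0] using ht
  refine mem_zariskiTangent_of_infinite (hfin.infinite_compl.mono fun t ht => ?_)
  have : (fun i => Sum.elim y.rep x.rep i + Sum.elim (0 : Fin (D.M + 1) → K) w i * t) =
      Sum.elim y.rep (x.rep + t • w) := by
    ext (i | i)
    · simp
    · simp [mul_comm]
  change (fun i => Sum.elim y.rep x.rep i + Sum.elim (0 : Fin (D.M + 1) → K) w i * t) ∈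
    bicone D.incidence
  rw [this, elim_mem_bicone_incidence]
  refine ⟨y.rep_nonzero, ht, hb, ?_⟩
  rw [D.toGrass_mk_rep ⟨y, h⟩ hb]
  exact Submodule.add_mem _ hx (Submodule.smul_mem _ _ hw)

theorem toBase_mem_embTangent {y : ProjSpace K D.M} {x : ProjSpace K N}
    {z : Fin (D.M + 1) ⊕ Fin (N + 1) → K}
    (hz : z ∈ zariskiTangent (bicone D.incidence) (Sum.elim y.rep x.rep)) :
    toBase K D.M N z ∈ embTangent D.carrier y := by
  have hr : ∀ z ∈ bicone D.incidence, z ∘ Sum.inl ∈ cone D.carrier := by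
    rintro _ ⟨u, v, hu, hv, rfl, h, -⟩
    exact ⟨hu, h⟩
  have h := comp_mem_zariskiTangent Sum.inl hr hz
  rw [Sum.elim_comp_inl] at h
  exact h

theorem finrank_incidenceTangent_le {y : ProjSpace K D.M} (h : y ∈ D.carrier) {x : ProjSpace K N} :
    finrank K (zariskiTangent (bicone D.incidence) (Sum.elim y.rep x.rep)) ≤
      finrank K (embTangent D.carrier y) + (k + 1) := by
  obtain ⟨L, hL, hLdim⟩ : ∃ L : Submodule K (Fin (N + 1) → K),
      L = (D.toGrass ⟨y, h⟩).1 ∧ finrank K L = k + 1 := ⟨_, rfl, (D.toGrass ⟨y, h⟩).2⟩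
  rw [← hLdim]
  refine finrank_le_of_map_le (toBase K D.M N) (toSpace K D.M N)
    (fun z hz => D.toBase_mem_embTangent hz) (fun z hz hz0 => ?_) fun z h1 h2 => ?_
  · rw [hL]
    refine D.mem_of_elim_zero_mem_incidenceTangent (x := x) h ?_
    have : (Sum.elim (0 : Fin (D.M + 1) → K) (toSpace K D.M N z) :
        Fin (D.M + 1) ⊕ Fin (N + 1) → K) = z := by
      ext (i | i)
      · exact (congrFun hz0 i).symm
      · rfl
    rw [this]
    exact hz
  · ext (i | i)
    · exact congrFun h1 i
    · exact congrFun h2 i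

/-- At a focus, the differential of the projection to `ℙ^N` is not injective. -/
theorem finrank_map_toSpace_le {y : ProjSpace K D.M} (h : y ∈ D.carrier) {x : ProjSpace K N}
    (hq : ((y, x) : BiProjSpace K D.M N) ∈ D.foci) :
    finrank K ((zariskiTangent (bicone D.incidence) (Sum.elim y.rep x.rep)).map
        (toSpace K D.M N)) + 2 ≤
      finrank K (embTangent D.carrier y) + (k + 1) := by
  refine le_trans ?_ (D.finrank_incidenceTangent_le (x := x) h)
  let f : (Fin (D.M + 1) → K) →ₗ[K] (Fin (D.M + 1) ⊕ Fin (N + 1) → K) :=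
    (LinearEquiv.sumArrowLequivProdArrow (Fin (D.M + 1)) (Fin (N + 1)) K K).symm.toLinearMap ∘ₗ
      LinearMap.inl K (Fin (D.M + 1) → K) (Fin (N + 1) → K)
  refine finrank_map_add_two_le (toSpace K D.M N) (D.characteristicMap (y, x)) f ?_ ?_ ?_ ?_
  · intro τ τ' h
    exact funext fun i => congrFun h (Sum.inl i)
  · intro τ hτ
    exact (Submodule.Quotient.mk_eq_zero _).1 hτ
  · intro τ
    rfl
  · exact lt_of_lt_of_le hq.2 (min_le_left _ _)

/-- If the projection to `ℙ^N` of a set of foci is of sufficiently large rank at a focus `(b, x)`,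
then the linear space of `b` is tangent to the focal locus at `x`. -/
theorem le_embTangent_focalLocus [Infinite K] {n : ℕ} {y : ProjSpace K D.M}
    (h : y ∈ D.carrier) {x : ProjSpace K N}
    (hq : ((y, x) : BiProjSpace K D.M N) ∈ D.foci)
    (hb : finrank K (embTangent D.carrier y) ≤ n + 1)
    {W : Set (BiProjSpace K D.M N)} (hW : W ⊆ D.foci)
    (hdim : n + k ≤ finrank K
      ((zariskiTangent (bicone W) (Sum.elim y.rep x.rep)).map (toSpace K D.M N))) :
    (D.toGrass ⟨y, h⟩).1 ≤ embTangent D.focalLocus x := by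
  have hc : (D.toGrass ⟨y, h⟩).Contains x := hq.1.2
  have hle : (zariskiTangent (bicone W) (Sum.elim y.rep x.rep)).map (toSpace K D.M N) ≤
      (zariskiTangent (bicone D.incidence) (Sum.elim y.rep x.rep)).map (toSpace K D.M N) := by
    refine Submodule.map_mono (zariskiTangent_mono ?_ _)
    rintro _ ⟨u, v, hu, hv, rfl, h⟩
    exact ⟨u, v, hu, hv, rfl, (hW h).1⟩
  -- At a focus `df(T I)` has dimension at most `(n + 1) + (k + 1) - 2 = n + k`, which `df(T W)`
  -- already attains.
  have heq := Submodule.eq_of_le_of_finrank_le hle (by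
    have := D.finrank_map_toSpace_le h hq
    omega)
  intro w hw
  have hmem : w ∈
      (zariskiTangent (bicone D.incidence) (Sum.elim y.rep x.rep)).map (toSpace K D.M N) :=
    ⟨_, D.elim_zero_mem_incidenceTangent h hc hw, rfl⟩
  rw [← heq] at hmem
  obtain ⟨z, hz, rfl⟩ := hmem
  have hr : ∀ z ∈ bicone W, z ∘ Sum.inr ∈ cone D.focalLocus := by
    rintro _ ⟨u, v, hu, hv, rfl, h⟩
    exact ⟨hv, _, hW h, rfl⟩
  have h := comp_mem_zariskiTangent Sum.inr hr hz
  rw [Sum.elim_comp_inr] at h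
  exact h

end Desingularization

/-! ### Dimension of quasi-affine varieties -/

/-- The dimension of a quasi-affine variety is at least the length of any chain of prime ideals of
subvarieties. -/
theorem length_le_topologicalKrullDim {K : Type*} [Field K] [IsAlgClosed K] {σ : Type*} [Finite σ]
    {V : Set (σ → K)} {h : MvPolynomial σ K} (l : LTSeries (PrimeSpectrum (MvPolynomial σ K)))
    (hl : ∀ i, h ∉ (l i).asIdeal)
    (hV : ∀ i v, (∀ p ∈ (l i).asIdeal, eval v p = 0) → eval v h ≠ 0 → v ∈ V) :
    (l.length : WithBot ℕ∞) ≤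
      @topologicalKrullDim V (TopologicalSpace.induced Subtype.val (zariski K σ)) := by
  let : TopologicalSpace V := TopologicalSpace.induced Subtype.val (zariski K σ)
  let T := {J : PrimeSpectrum (MvPolynomial σ K) // h ∉ J.asIdeal ∧
    ∀ v, (∀ p ∈ J.asIdeal, eval v p = 0) → eval v h ≠ 0 → v ∈ V}
  have hpt : ∀ (J : T) (p : MvPolynomial σ K), p ∉ J.1.asIdeal →
      ∃ v : V, (∀ p ∈ J.1.asIdeal, eval v.1 p = 0) ∧ eval v.1 p ≠ 0 := by
    intro J p hp
    -- With the product `p * h` in the Nullstellensatz, the point found also avoids `h = 0` and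
    -- hence lies in `V`.
    have hph : p * h ∉ J.1.asIdeal := fun hcon => (J.1.2.mem_or_mem hcon).elim hp J.2.1
    rw [← IsPrime.vanishingIdeal_zeroLocus (K := K) J.1.asIdeal, mem_vanishingIdeal] at hph
    push Not at hph
    obtain ⟨v, hv, hv'⟩ := hph
    rw [map_mul] at hv'
    exact ⟨⟨v, J.2.2 v hv (right_ne_zero_of_mul hv')⟩, hv, left_ne_zero_of_mul hv'⟩
  let Z : T → Set V := fun J => {v | ∀ p ∈ J.1.asIdeal, eval v.1 p = 0}
  have hclosed : ∀ J, IsClosed (Z J) := fun J =>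
    isClosed_induced_zariski.2 ⟨J.1.asIdeal, fun v => Iff.rfl⟩
  have hirr : ∀ J, IsIrreducible (Z J) := by
    intro J
    refine ⟨?_, ?_⟩
    · obtain ⟨v, hv, -⟩ := hpt J 1 ((Ideal.ne_top_iff_one _).1 J.1.2.ne_top)
      exact ⟨v, hv⟩
    · rw [isPreirreducible_iff_isClosed_union_isClosed]
      intro z₁ z₂ h₁ h₂ hz
      obtain ⟨S₁, hS₁⟩ := isClosed_induced_zariski.1 h₁
      obtain ⟨S₂, hS₂⟩ := isClosed_induced_zariski.1 h₂
      by_contra! hcon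
      obtain ⟨⟨v₁, hv₁, hn₁⟩, v₂, hv₂, hn₂⟩ := hcon.imp Set.not_subset.1 Set.not_subset.1
      rw [hS₁] at hn₁
      rw [hS₂] at hn₂
      push Not at hn₁ hn₂
      obtain ⟨p₁, hp₁, hne₁⟩ := hn₁
      obtain ⟨p₂, hp₂, hne₂⟩ := hn₂
      obtain ⟨v, hv, hne⟩ := hpt J (p₁ * p₂) fun hcon =>
        (J.1.2.mem_or_mem hcon).elim (fun h => hne₁ (hv₁ _ h)) (fun h => hne₂ (hv₂ _ h))
      rw [map_mul] at hne
      rcases hz hv with h | h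
      · exact left_ne_zero_of_mul hne ((hS₁ v).1 h _ hp₁)
      · exact right_ne_zero_of_mul hne ((hS₂ v).1 h _ hp₂)
  let F : T → (TopologicalSpace.IrreducibleCloseds V)ᵒᵈ := fun J =>
    OrderDual.toDual ⟨Z J, hirr J, hclosed J⟩
  have hF : StrictMono F := by
    intro J J' hJ
    obtain ⟨p, hp', hp⟩ := SetLike.exists_of_lt (show J.1.asIdeal < J'.1.asIdeal from hJ)
    refine lt_of_le_not_ge (fun v (hv : v ∈ Z J') p hp => hv p (hJ.le hp)) fun hcon => ?_
    obtain ⟨v, hv, hne⟩ := hpt J p hp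
    have hvJ' : v ∈ Z J' := (show Z J ⊆ Z J' from hcon) hv
    exact hne (hvJ' p hp')
  let l' : LTSeries T :=
    { length := l.length
      toFun := fun i => ⟨l i, hl i, hV i⟩
      step := fun i => l.step i }
  have h1 := Order.krullDim_le_of_strictMono F hF
  rw [Order.krullDim_orderDual] at h1
  exact le_trans (Order.LTSeries.length_le_krullDim l') h1

/-! ### The quotient map from frames to the Grassmannian -/

theorem frame_span_eq_iff {K : Type*} [Field K] {N k : ℕ} (A A' : Frame K N k) :
    A'.span = A.span ↔ ∃ g : Matrix (Fin (k + 1)) (Fin (k + 1)) K, g.det ≠ 0 ∧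
      A'.1 = (g * Matrix.of A.1 : Matrix (Fin (k + 1)) (Fin (N + 1)) K) := by
  constructor
  · intro h
    have hmem : ∀ i, ∃ a : Fin (k + 1) → K, Matrix.vecMul a (Matrix.of A.1) = A'.1 i := by
      intro i
      have : A'.1 i ∈ (A'.span).1 := Submodule.subset_span ⟨i, rfl⟩
      rw [h] at this
      change A'.1 i ∈ Submodule.span K (Set.range (Matrix.of A.1).row) at this
      rw [← range_vecMulLinear] at this
      exact this
    choose g hg using hmem
    have hgA : A'.1 = (Matrix.of g * Matrix.of A.1 : Matrix (Fin (k + 1)) (Fin (N + 1)) K) :=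
      funext fun i => (hg i).symm
    refine ⟨Matrix.of g, fun hdet => ?_, hgA⟩
    obtain ⟨a, ha, hag⟩ := Matrix.exists_vecMul_eq_zero_iff.2 hdet
    refine ha ?_
    have hinj : Function.Injective fun a => Matrix.vecMul a (Matrix.of A'.1) :=
      Matrix.vecMul_injective_iff.2 A'.2
    refine hinj ?_
    have h0 : Matrix.of A'.1 = Matrix.of g * Matrix.of A.1 := hgA
    simp only [h0]
    rw [← Matrix.vecMul_vecMul, hag, Matrix.zero_vecMul, Matrix.zero_vecMul]
  · rintro ⟨g, -, hg⟩
    refine Subtype.ext (Submodule.eq_of_le_of_finrank_eq (Submodule.span_le.2 ?_) ?_)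
    · rintro _ ⟨i, rfl⟩
      change _ ∈ Submodule.span K (Set.range (Matrix.of A.1).row)
      rw [← range_vecMulLinear, hg]
      exact ⟨g i, rfl⟩
    · exact A'.span.2.trans A.span.2.symm

/-- The linear spaces that have a frame at which a given polynomial does not vanish form an open
subset of the Grassmannian. -/
theorem isOpen_setOf_exists_frame {K : Type*} [Field K] {N k : ℕ}
    (r : MvPolynomial (Fin (k + 1) × Fin (N + 1)) K) :
    IsOpen {L : Grass K N k | ∃ A : Frame K N k, A.span = L ∧ eval (entries A.1) r ≠ 0} := by
  rw [← isClosed_compl_iff, isClosed_grass_iff]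
  -- `R g` is `r` after the change of frame `g`. The complement is cut out by all `R g` with `g`
  -- invertible.
  let R : Matrix (Fin (k + 1)) (Fin (k + 1)) K → MvPolynomial (Fin (k + 1) × Fin (N + 1)) K :=
    fun g => aeval (fun ij => ∑ l, C (g ij.1 l) * X (l, ij.2)) r
  have hR : ∀ (g : Matrix (Fin (k + 1)) (Fin (k + 1)) K) (A : Fin (k + 1) → Fin (N + 1) → K),
      eval (entries A) (R g) = eval (entries (g * Matrix.of A : Matrix _ _ K)) r := by
    intro g A
    rw [eval_aeval]
    congr 2
    ext ij
    simp [entries, Matrix.mul_apply]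
  refine ⟨{p | ∃ g : Matrix (Fin (k + 1)) (Fin (k + 1)) K, g.det ≠ 0 ∧ p = R g}, fun A => ?_⟩
  constructor
  · rintro hA p ⟨g, hg, rfl⟩
    by_contra hne
    rw [hR] at hne
    have hind : LinearIndependent K (g * Matrix.of A.1).row := by
      rw [← Matrix.vecMul_injective_iff]
      have h1 : Function.Injective fun a => Matrix.vecMul a g :=
        Matrix.vecMul_injective_iff_isUnit.2 ((Matrix.isUnit_iff_isUnit_det _).2 hg.isUnit)
      have h2 : Function.Injective fun a => Matrix.vecMul a (Matrix.of A.1) :=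
        Matrix.vecMul_injective_iff.2 A.2
      intro a b hab
      refine h1 (h2 ?_)
      simpa only [Matrix.vecMul_vecMul] using hab
    exact hA ⟨⟨_, hind⟩, (frame_span_eq_iff _ _).2 ⟨g, hg, rfl⟩, hne⟩
  · rintro h ⟨A', hspan, hne⟩
    obtain ⟨g, hg, hgA⟩ := (frame_span_eq_iff _ _).1 hspan
    rw [hgA, ← hR] at hne
    exact hne (h _ ⟨g, hg, rfl⟩)

/-- Clearing of denominators. -/
theorem exists_eval_eq_pow_mul {K : Type*} [Field K] {ι τ : Type*} (f : ι → MvPolynomial τ K)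
    (g : MvPolynomial τ K) (p : MvPolynomial ι K) :
    ∃ (m : ℕ) (r : MvPolynomial τ K), ∀ t, eval t g ≠ 0 →
      eval t r = eval t g ^ m * eval (fun i => eval t (f i) / eval t g) p := by
  induction p using MvPolynomial.induction_on with
  | C a => exact ⟨0, C a, fun t _ => by simp⟩
  | add p q hp hq =>
    obtain ⟨m, r, hr⟩ := hp
    obtain ⟨m', r', hr'⟩ := hq
    refine ⟨m + m', g ^ m' * r + g ^ m * r', fun t ht => ?_⟩
    simp only [map_add, map_mul, map_pow, hr t ht, hr' t ht]
    ring
  | mul_X p i hp =>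
    obtain ⟨m, r, hr⟩ := hp
    refine ⟨m + 1, r * f i, fun t ht => ?_⟩
    simp only [map_mul, hr t ht, eval_X]
    field_simp
    ring

/-! ### The dimension of a desingularization -/

theorem mk_mem_of_isClosed {K : Type*} [Field K] {N : ℕ} {Z : Set (ProjSpace K N)}
    (hZ : IsClosed Z) {v : Fin (N + 1) → K} (hv : v ≠ 0)
    (h : ∀ p ∈ vanishingIdeal K (cone Z), eval v p = 0) : Projectivization.mk K v hv ∈ Z := by
  obtain ⟨S, hS⟩ := isClosed_projSpace_iff.1 hZ
  rw [hS]
  refine fun p hp => h p (mem_vanishingIdeal.2 ?_)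
  rintro w ⟨hw, hwZ⟩
  exact (hS w hw).1 hwZ p hp

/-- The dimension of a desingularization of `B` is at most that of `B`. -/
theorem Desingularization.le_topologicalKrullDim {K : Type*} [Field K] [IsAlgClosed K] {N k d : ℕ}
    {B : Set (Grass K N k)} (D : Desingularization B)
    (hd : ((d + 1 : ℕ) : WithBot ℕ∞) ≤
      ringKrullDim (MvPolynomial (Fin (D.M + 1)) K ⧸ vanishingIdeal K (cone D.carrier))) :
    (d : WithBot ℕ∞) ≤ topologicalKrullDim B := by
  have hP := isPrime_vanishingIdeal_cone D.isIrreducible_carrier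
  obtain ⟨O, hO, ⟨L₀, hL₀⟩, σ, hσ, hσD⟩ := D.birational
  obtain ⟨y₀, rfl⟩ : L₀ ∈ Set.range D.toGrass := by
    rw [D.range_eq]; exact hL₀.1
  obtain ⟨A, Q, δ, hδ, hA⟩ := D.regular.exists_frame y₀
  have hy₀ : Projectivization.mk K y₀.1.rep y₀.1.rep_nonzero ∈ D.carrier := by
    rw [y₀.1.mk_rep]; exact y₀.2
  obtain ⟨hA₀, hspan₀, -⟩ := hA _ y₀.1.rep_nonzero hy₀ hδ
  rw [D.toGrass_mk_rep y₀ hy₀] at hspan₀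
  let pull : MvPolynomial (Fin (k + 1) × Fin (N + 1)) K → MvPolynomial (Fin (D.M + 1)) K :=
    fun p => aeval (fun ij => A ij.1 ij.2) p
  have hpull : ∀ u p, eval u (pull p) = eval (entries (A.map (eval u)).row) p :=
    fun u p => eval_aeval u _ p
  obtain ⟨S, hS⟩ := isClosed_grass_iff.1 hO.isClosed_compl
  have hmem₀ : Frame.span ⟨_, hA₀⟩ ∈ B ∩ O := hspan₀ ▸ hL₀
  obtain ⟨s, hsS, hs⟩ : ∃ s ∈ S, eval y₀.1.rep (pull s) ≠ 0 := by
    have h1 := mt (hS ⟨_, hA₀⟩).2 (not_not.2 hmem₀.2)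
    push Not at h1
    simpa only [hpull] using h1
  obtain ⟨P, hP₀, hPσ⟩ := hσ ⟨_, hA₀⟩ hmem₀
  obtain ⟨j, hj⟩ := Function.ne_iff.1 hP₀
  have hσA : ∀ (u : Fin (D.M + 1) → K) (hu : u ≠ 0)
      (hY : Projectivization.mk K u hu ∈ D.carrier), D.toGrass ⟨_, hY⟩ ∈ B ∩ O →
      ∀ A' : Frame K N k, A'.span = D.toGrass ⟨_, hY⟩ → eval (entries A'.1) (P j) ≠ 0 →
      ∃ a : K, a ≠ 0 ∧ u = a • fun i => eval (entries A'.1) (P i) := by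
    intro u hu hY hmem A' hA' hj'
    have hne : (fun i => eval (entries A'.1) (P i)) ≠ 0 := fun h => hj' (congrFun h j)
    rw [← mk_eq_mk_iff_exists_ne_zero hu hne, ← hPσ A' (hA' ▸ hmem) hne]
    refine (hσD ⟨_, hY⟩ hmem).symm.trans (congrArg σ (Subtype.ext hA'.symm))
  have hj₀ : y₀.1.rep j ≠ 0 := by
    obtain ⟨a, ha, h⟩ := hσA _ y₀.1.rep_nonzero hy₀ (by rwa [D.toGrass_mk_rep y₀ hy₀])
      ⟨_, hA₀⟩ (by rw [D.toGrass_mk_rep y₀ hy₀, hspan₀]) hj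
    rw [h]
    exact mul_ne_zero ha hj
  -- Where `h` does not vanish, `A` is a frame, its span lies in `O`, the `j`-th coordinate of the
  -- local inverse is non-zero on `A`, and `u j ≠ 0`.
  let h := δ * pull s * pull (P j) * X j
  have hh : h ∉ vanishingIdeal K (cone D.carrier) := by
    intro hcon
    have h0 := eval_eq_zero_of_mem hcon (rep_mem_cone y₀.2)
    simp only [h, map_mul, eval_X] at h0
    refine mul_ne_zero (mul_ne_zero (mul_ne_zero hδ hs) ?_) hj₀ h0
    rw [hpull]
    exact hj
  obtain ⟨c, l, hld, hl⟩ := exists_ltSeries_hyperplane _ hh j hd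
  -- The slice `u j = c` selects at most one representative of each point of `B'`. It lowers the
  -- dimension of the cone from `d + 1` to `d`.
  let V : Set (Fin (D.M + 1) → K) := {u |
    (∀ p ∈ vanishingIdeal K (cone D.carrier), eval u p = 0) ∧ u j = c ∧ eval u h ≠ 0}
  have hne : ∀ u : V, eval u.1 δ ≠ 0 ∧ eval u.1 (pull s) ≠ 0 ∧ eval u.1 (pull (P j)) ≠ 0 ∧
      u.1 j ≠ 0 := by
    intro u
    have := u.2.2.2
    simp only [h, map_mul, eval_X, mul_ne_zero_iff] at this
    exact ⟨this.1.1.1, this.1.1.2, this.1.2, this.2⟩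
  have hu0 : ∀ u : V, u.1 ≠ 0 := fun u h0 => (hne u).2.2.2 (congrFun h0 j)
  have huY : ∀ u : V, Projectivization.mk K u.1 (hu0 u) ∈ D.carrier := fun u =>
    mk_mem_of_isClosed D.isClosed_carrier _ u.2.1
  let ψ : V → B := fun u => ⟨D.toGrass ⟨_, huY u⟩, by
    have : D.toGrass ⟨_, huY u⟩ ∈ Set.range D.toGrass := ⟨_, rfl⟩
    rwa [D.range_eq] at this⟩
  have hψ : ∀ u : V, ∃ hu : LinearIndependent K (A.map (eval u.1)).row,
      (ψ u).1 = Frame.span ⟨_, hu⟩ := fun u => by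
    obtain ⟨h1, h2, -⟩ := hA u.1 (hu0 u) (huY u) (hne u).1
    exact ⟨h1, h2⟩
  have hψO : ∀ u : V, (ψ u).1 ∈ B ∩ O := by
    intro u
    refine ⟨(ψ u).2, ?_⟩
    by_contra hcon
    obtain ⟨hu, hspan⟩ := hψ u
    rw [hspan] at hcon
    refine (hne u).2.1 ?_
    rw [hpull]
    exact (hS ⟨_, hu⟩).1 hcon s hsS
  -- The inverse `σ` determines `u` up to a scalar, and `u j = c` fixes the scalar; so `u` is a
  -- rational function of any frame of its image.
  have hrec : ∀ (u : V) (A' : Frame K N k), A'.span = (ψ u).1 → eval (entries A'.1) (P j) ≠ 0 →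
      (fun i => eval (entries A'.1) (C c * P i) / eval (entries A'.1) (P j)) = u.1 := by
    intro u A' hA' hj'
    obtain ⟨a, ha, hua⟩ := hσA u.1 (hu0 u) (huY u) (hψO u) A' hA' hj'
    have hc := u.2.2.1
    rw [hua] at hc
    ext i
    rw [hua, ← hc]
    simp only [map_mul, eval_C, Pi.smul_apply, smul_eq_mul]
    field_simp
  let : TopologicalSpace V := TopologicalSpace.induced Subtype.val (zariski K _)
  have hind : Topology.IsInducing ψ := by
    refine ⟨TopologicalSpace.ext_iff_isClosed.2 fun Z => ?_⟩
    constructor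
    · intro hZ
      obtain ⟨T, hT⟩ := isClosed_induced_zariski.1 hZ
      choose m r hr using fun p : MvPolynomial (Fin (D.M + 1)) K =>
        exists_eval_eq_pow_mul (fun i => C c * P i) (P j) p
      -- The equations of the closed set, rewritten on frames and cleared of denominators. The
      -- factor `P j` makes them trivial at frames where the inversion formula is undefined.
      have hU : IsOpen (⋃ p ∈ T, {L : Grass K N k | ∃ A' : Frame K N k, A'.span = L ∧
          eval (entries A'.1) (r p * P j) ≠ 0}) :=
        isOpen_biUnion fun p _ => isOpen_setOf_exists_frame _
      refine isClosed_induced_iff.2 ⟨_, (hU.preimage continuous_subtype_val).isClosed_compl, ?_⟩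
      ext u
      rw [hT, Set.mem_preimage, Set.mem_compl_iff, Set.mem_preimage]
      simp only [Set.mem_iUnion, Set.mem_ofPred_eq, not_exists, not_and, ne_eq, not_not]
      constructor
      · intro hu p hp
        by_contra hpu
        obtain ⟨hAu, hspan⟩ := hψ u
        have hju : eval (entries (A.map (eval u.1)).row) (P j) ≠ 0 := by
          rw [← hpull]; exact (hne u).2.2.1
        have h0 := hu p hp ⟨_, hAu⟩ hspan.symm
        dsimp only at h0
        rw [map_mul, hr p _ hju, hrec u ⟨_, hAu⟩ hspan.symm hju] at h0
        exact mul_ne_zero (mul_ne_zero (pow_ne_zero _ hju) hpu) hju h0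
      · intro hu p hp A' hA'
        rw [map_mul]
        by_cases hj' : eval (entries A'.1) (P j) = 0
        · rw [hj', mul_zero]
        · rw [hr p _ hj', hrec u A' hA' hj', hu p hp, mul_zero, zero_mul]
    · intro hZ
      obtain ⟨T, hT, rfl⟩ := isClosed_induced_iff.1 hZ
      obtain ⟨T', hT', rfl⟩ := isClosed_induced_iff.1 hT
      obtain ⟨R, hR⟩ := isClosed_grass_iff.1 hT'
      refine isClosed_induced_zariski.2 ⟨pull '' R, fun u => ?_⟩
      obtain ⟨hAu, hspan⟩ := hψ u
      rw [Set.mem_preimage, Set.mem_preimage, hspan, hR, Set.forall_mem_image]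
      simp only [hpull]
  rw [← hld]
  have hlen : (l.length : WithBot ℕ∞) ≤ topologicalKrullDim V :=
    length_le_topologicalKrullDim (h := h) l (fun i => (hl i).2.1) fun i v hv hvh => by
      have hvj := hv _ (hl i).2.2
      rw [map_sub, eval_X, eval_C, sub_eq_zero] at hvj
      exact ⟨fun p hp => hv p ((hl i).1 hp), hvj, hvh⟩
  exact hlen.trans hind.topologicalKrullDim_le

/-- Nonsingularity makes the left side `dim B' + 1`, which the dimension of the homogeneous
coordinate ring bounds; the hyperplane slice then compares it with `dim B`. -/
theorem Desingularization.finrank_embTangent_le {K : Type*} [Field K] [IsAlgClosed K] {N k n : ℕ}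
    {B : Set (Grass K N k)} (D : Desingularization B)
    (hB : topologicalKrullDim B = (n : WithBot ℕ∞)) {y : ProjSpace K D.M} (hy : y ∈ D.carrier) :
    finrank K (embTangent D.carrier y) ≤ n + 1 := by
  have h := topologicalKrullDim_add_one_le (K := K) ⟨y, hy⟩
  rw [← D.nonsingular y hy] at h
  obtain hd | ⟨d, hd⟩ : finrank K (embTangent D.carrier y) = 0 ∨
      ∃ d, finrank K (embTangent D.carrier y) = d + 1 := by
    cases finrank K (embTangent D.carrier y) <;> simp
  · omega
  · rw [hd] at h ⊢
    have := D.le_topologicalKrullDim h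
    rw [hB] at this
    have : d ≤ n := by exact_mod_cast this
    omega

/-! ### Irreducible components of a subset of a Noetherian space -/

/-- A subset of a Noetherian space is the union of its finitely many maximal irreducible
subsets. -/
theorem exists_finite_maximal_isIrreducible {E : Type*} [TopologicalSpace E]
    [TopologicalSpace.NoetherianSpace E] (S : Set E) :
    ∃ C : Set (Set E), C.Finite ∧ (∀ W ∈ C, Maximal (fun Z => IsIrreducible Z ∧ Z ⊆ S) W) ∧
      ∀ x ∈ S, ∃ W ∈ C, x ∈ W := by
  have : TopologicalSpace.NoetherianSpace S := Topology.IsInducing.subtypeVal.noetherianSpace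
  refine ⟨(fun W => Subtype.val '' W) '' irreducibleComponents S,
    TopologicalSpace.NoetherianSpace.finite_irreducibleComponents.image _, ?_, fun x hx =>
      ⟨_, ⟨_, irreducibleComponent_mem_irreducibleComponents ⟨x, hx⟩, rfl⟩, _,
        mem_irreducibleComponent, rfl⟩⟩
  rintro _ ⟨W, hW, rfl⟩
  refine ⟨⟨hW.1.image _ continuous_subtype_val.continuousOn, Subtype.coe_image_subset S W⟩,
    fun Z hZ hWZ => ?_⟩
  have hZS : Subtype.val '' (Subtype.val ⁻¹' Z : Set S) = Z :=
    Subtype.image_preimage_coe S Z |>.trans (Set.inter_eq_right.2 hZ.2)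
  have hpre : IsIrreducible (Subtype.val ⁻¹' Z : Set S) := by
    refine ⟨?_, isPreirreducible_iff_isClosed_union_isClosed.2 ?_⟩
    · obtain ⟨z, hz⟩ := hZ.1.nonempty
      exact ⟨⟨z, hZ.2 hz⟩, hz⟩
    · intro z₁ z₂ h₁ h₂ h
      obtain ⟨t₁, ht₁, rfl⟩ := isClosed_induced_iff.1 h₁
      obtain ⟨t₂, ht₂, rfl⟩ := isClosed_induced_iff.1 h₂
      refine (isPreirreducible_iff_isClosed_union_isClosed.1 hZ.1.isPreirreducible t₁ t₂ ht₁ ht₂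
        fun z hz => h (show (⟨z, hZ.2 hz⟩ : S) ∈ _ from hz)).imp ?_ ?_
      · exact fun h z hz => h hz
      · exact fun h z hz => h hz
  have hle : W ⊆ Subtype.val ⁻¹' Z := Set.image_subset_iff.1 hWZ
  have := hW.2 hpre hle
  rw [← hZS]
  exact Set.image_mono this

/-- A point of an irreducible set that avoids finitely many closed sets not containing it. -/
theorem IsIrreducible.nonempty_inter_compl_biUnion {E ι : Type*} [TopologicalSpace E] {B : Set E}
    (hB : IsIrreducible B) {C : Set ι} (hC : C.Finite) {T : ι → Set E}
    (hT : ∀ i ∈ C, IsClosed (T i)) (hBT : ∀ i ∈ C, ¬ B ⊆ T i) :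
    (B ∩ (⋃ i ∈ C, T i)ᶜ).Nonempty := by
  classical
  by_contra hcon
  rw [← Set.sdiff_eq, Set.not_nonempty_iff_eq_empty, Set.sdiff_eq_empty] at hcon
  obtain ⟨z, hz, hBz⟩ := isIrreducible_iff_sUnion_isClosed.1 hB (hC.toFinset.image T)
    (by simpa using hT) (by simpa using hcon)
  obtain ⟨i, hi, rfl⟩ := Finset.mem_image.1 hz
  exact hBT i (hC.mem_toFinset.1 hi) hBz

/-! ### Tangency along a component of the foci -/

/-- In characteristic zero, the projection to `ℙ^N` of an irreducible subset `W` of `ℙ^M × ℙ^N`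
has a differential of rank at least the dimension of the image at a general point of `W`. -/
theorem exists_le_finrank_map_toSpace {K : Type*} [Field K] [Infinite K] [CharZero K] {M N e : ℕ}
    {W : Set (BiProjSpace K M N)} (hW : IsIrreducible W) {Z : Set (ProjSpace K N)}
    (hZ : ∀ x, x ∈ Z ↔ ∃ y : ProjSpace K M, ((y, x) : BiProjSpace K M N) ∈ W)
    (he : (e : WithBot ℕ∞) ≤
      ringKrullDim (MvPolynomial (Fin (N + 1)) K ⧸ vanishingIdeal K (cone Z))) :
    ∃ H ∉ vanishingIdeal K (bicone W), ∀ z ∈ bicone W, eval z H ≠ 0 →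
      e ≤ finrank K ((zariskiTangent (bicone W) z).map (toSpace K M N)) := by
  have hP := isPrime_vanishingIdeal_bicone hW
  let f : MvPolynomial (Fin (N + 1)) K →ₐ[K] MvPolynomial (Fin (M + 1) ⊕ Fin (N + 1)) K :=
    rename Sum.inr
  -- `W` maps onto `Z`, so the coordinate ring of the cone over `Z` embeds in that of the bicone,
  -- and independent coordinates remain independent.
  have hI : vanishingIdeal K (cone Z) = (vanishingIdeal K (bicone W)).comap f := by
    ext p
    rw [Ideal.mem_comap, mem_vanishingIdeal, mem_vanishingIdeal]
    constructor
    · rintro h _ ⟨u, v, hu, hv, rfl, hq⟩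
      rw [eval_rename, Sum.elim_comp_inr]
      exact h v ⟨hv, (hZ _).2 ⟨_, hq⟩⟩
    · rintro h v ⟨hv, hvZ⟩
      obtain ⟨y, hy⟩ := (hZ _).1 hvZ
      have := h (Sum.elim y.rep v) (mk_mem_bicone.2 ⟨y.rep_nonzero, hv, by rwa [y.mk_rep]⟩)
      rwa [eval_rename, Sum.elim_comp_inr] at this
  rw [hI] at he
  obtain ⟨x, hx⟩ := exists_algebraicIndependent_X _ he
  have hx' := hx.map' (f := Ideal.quotientMapₐ (vanishingIdeal K (bicone W)) f le_rfl)
    Ideal.quotientMap_injective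
  have hx'' : AlgebraicIndependent K fun a =>
      Ideal.Quotient.mk (vanishingIdeal K (bicone W)) (X (Sum.inr (x a))) := by
    convert hx' using 1
    · ext a
      simp [f]
    · rfl
  obtain ⟨H, w, hH, hwx, hwp⟩ := exists_tangent_vectors _ (fun a => Sum.inr (x a)) hx''
  refine ⟨H, hH, fun z hz hHz => ?_⟩
  have hw : ∀ a, (fun s => eval z (w a s)) ∈ zariskiTangent (bicone W) z := by
    intro a p hp
    have := eval_eq_zero_of_mem (hwp a p (mem_vanishingIdeal.2 hp)) hz
    simpa using this
  -- In the selected coordinates these vectors form `H(z)` times the identity matrix.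
  let b : Fin e → (zariskiTangent (bicone W) z).map (toSpace K M N) := fun a =>
    ⟨_, _, hw a, rfl⟩
  have hb : ∀ a a', (b a).1 (x a') = if a = a' then eval z H else 0 := by
    intro a a'
    have := eval_eq_zero_of_mem (hwx a a') hz
    rw [map_sub, sub_eq_zero] at this
    refine this.trans ?_
    split_ifs <;> simp
  have hlin : LinearIndependent K b := by
    rw [Fintype.linearIndependent_iff]
    intro c hc a
    have := congrArg (fun y : (zariskiTangent (bicone W) z).map (toSpace K M N) => y.1 (x a)) hc
    simp only [Submodule.coe_sum, Submodule.coe_smul, Finset.sum_apply, Pi.smul_apply, hb,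
      smul_eq_mul, mul_ite, mul_zero, Finset.sum_ite_eq', Finset.mem_univ, if_true,
      Submodule.coe_zero, Pi.zero_apply] at this
    exact (mul_eq_zero.1 this).resolve_right hHz
  simpa using hlin.fintype_card_le_finrank

/-- Carries rank bounds from arbitrary points of the bicone to chosen representatives: rescaling
multiplies the projected vector by `t`, which a subspace absorbs. -/
theorem map_toSpace_zariskiTangent_le {K : Type*} [Field K] {M N : ℕ}
    {W : Set (BiProjSpace K M N)} {s t : K} (hs : s ≠ 0) (ht : t ≠ 0) (u : Fin (M + 1) → K)
    (v : Fin (N + 1) → K) :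
    (zariskiTangent (bicone W) (Sum.elim u v)).map (toSpace K M N) ≤
      (zariskiTangent (bicone W) (Sum.elim (s • u) (t • v))).map (toSpace K M N) := by
  rintro _ ⟨w, hw, rfl⟩
  rw [← Submodule.smul_mem_iff _ ht]
  have h := mem_zariskiTangent_of_scale _ (fun z hz => smul_mem_bicone (Z := W) hs ht hz) hw
  have hz : (fun i => Sum.elim (fun _ => s) (fun _ => t) i * Sum.elim u v i) =
      Sum.elim (s • u) (t • v) := by
    ext (i | i) <;> simp
  rw [hz] at h
  exact ⟨_, h, rfl⟩

namespace Desingularization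

variable {K : Type*} [Field K] [IsAlgClosed K] [CharZero K] {N k n : ℕ} {B : Set (Grass K N k)}
  (D : Desingularization B)

/-- The linear spaces are tangent to the focal locus at all points of an irreducible set of foci
with an image of codimension one. -/
theorem le_embTangent_of_mem (hB : topologicalKrullDim B = (n : WithBot ℕ∞))
    {W : Set (BiProjSpace K D.M N)} (hW : IsIrreducible W) (hWf : W ⊆ D.foci)
    (hdim : topologicalKrullDim (D.imageInSpace W) + 1 = ((n + k : ℕ) : WithBot ℕ∞))
    {y : ProjSpace K D.M} {x : ProjSpace K N} (hq : ((y, x) : BiProjSpace K D.M N) ∈ W)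
    (hy : y ∈ D.carrier) : (D.toGrass ⟨y, hy⟩).1 ≤ embTangent D.focalLocus x := by
  have hP := isPrime_vanishingIdeal_bicone hW
  -- The image has dimension `n + k - 1`; its cone has one more.
  have he : ((n + k : ℕ) : WithBot ℕ∞) ≤ ringKrullDim
      (MvPolynomial (Fin (N + 1)) K ⧸ vanishingIdeal K (cone (D.imageInSpace W))) :=
    hdim ▸ topologicalKrullDim_add_one_le ⟨x, _, hq, rfl⟩
  have hZ : ∀ x, x ∈ D.imageInSpace W ↔
      ∃ y : ProjSpace K D.M, ((y, x) : BiProjSpace K D.M N) ∈ W := fun x =>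
    ⟨by rintro ⟨q, hq, rfl⟩; exact ⟨q.1, hq⟩, fun ⟨y, hy⟩ => ⟨_, hy, rfl⟩⟩
  obtain ⟨H, hH, hrank⟩ := exists_le_finrank_map_toSpace hW hZ he
  have hgen : ∀ (u : Fin (D.M + 1) → K) (v : Fin (N + 1) → K), Sum.elim u v ∈ bicone W →
      eval (Sum.elim u v) H ≠ 0 → ∀ (hu : u ≠ 0) (hY : Projectivization.mk K u hu ∈ D.carrier),
      (D.toGrass ⟨_, hY⟩).1 ≤ zariskiTangent (cone D.focalLocus) v := by
    intro u v hz hHz hu hY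
    obtain ⟨_, hv, hqW⟩ := mk_mem_bicone.1 hz
    set y' := Projectivization.mk K u hu with hy'
    set x' := Projectivization.mk K v hv with hx'
    obtain ⟨s, hs, hsu⟩ := (mk_eq_mk_iff_exists_ne_zero y'.rep_nonzero hu).1 (y'.mk_rep.trans hy')
    obtain ⟨t, ht, htv⟩ := (mk_eq_mk_iff_exists_ne_zero x'.rep_nonzero hv).1 (x'.mk_rep.trans hx')
    have hle := map_toSpace_zariskiTangent_le (W := W) hs ht u v
    rw [← hsu, ← htv] at hle
    have h1 := D.le_embTangent_focalLocus hY (hWf hqW) (D.finrank_embTangent_le hB hY) hWf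
      ((hrank _ hz hHz).trans (Submodule.finrank_mono hle))
    intro w hw
    have h2 := smul_mem_zariskiTangent_cone (inv_ne_zero ht) (h1 hw)
    rwa [htv, inv_smul_smul₀ ht] at h2
  obtain ⟨A, Q, δ, hδ, hA⟩ := D.regular.exists_frame ⟨y, hy⟩
  have hmem : Sum.elim y.rep x.rep ∈ bicone W :=
    mk_mem_bicone.2 ⟨y.rep_nonzero, x.rep_nonzero, by rwa [y.mk_rep, x.mk_rep]⟩
  have hδP : rename Sum.inl δ ∉ vanishingIdeal K (bicone W) := by
    intro hcon
    have := eval_eq_zero_of_mem hcon hmem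
    rw [eval_rename, Sum.elim_comp_inl] at this
    exact hδ this
  have hY : Projectivization.mk K y.rep y.rep_nonzero ∈ D.carrier := by
    rw [y.mk_rep]; exact hy
  obtain ⟨hAy, hspan, -⟩ := hA _ y.rep_nonzero hY hδ
  rw [D.toGrass_mk_rep ⟨y, hy⟩ hY] at hspan
  rw [hspan]
  refine Submodule.span_le.2 ?_
  rintro _ ⟨i, rfl⟩ p hp
  -- `Ψ(u, v)` is the derivative of `p` at `v` along the `i`-th frame vector over `u`. It vanishes
  -- on `W` wherever `H` and `δ` do not, hence on all of `W`, since the ideal of the bicone is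
  -- prime.
  let Ψ : MvPolynomial (Fin (D.M + 1) ⊕ Fin (N + 1)) K :=
    ∑ j, rename Sum.inl (A i j) * rename Sum.inr (pderiv j p)
  have hΨ : ∀ u v, eval (Sum.elim u v) Ψ = ∑ j, eval u (A i j) * eval v (pderiv j p) := by
    intro u v
    simp [Ψ, eval_rename, Sum.elim_comp_inl, Sum.elim_comp_inr]
  have hprod : H * rename Sum.inl δ * Ψ ∈ vanishingIdeal K (bicone W) := by
    refine mem_vanishingIdeal.2 ?_
    rintro _ ⟨u, v, hu, hv, rfl, hqW⟩
    rw [map_mul, map_mul, eval_rename, Sum.elim_comp_inl]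
    by_cases hHz : eval (Sum.elim u v) H = 0
    · rw [hHz, zero_mul, zero_mul]
    by_cases hδu : eval u δ = 0
    · rw [hδu, mul_zero, zero_mul]
    have hYu : Projectivization.mk K u hu ∈ D.carrier := (hWf hqW).1.1
    obtain ⟨hAu, hspanu, -⟩ := hA u hu hYu hδu
    have hmemA : (A.map (eval u)).row i ∈ (D.toGrass ⟨_, hYu⟩).1 := by
      rw [hspanu]
      exact Submodule.subset_span ⟨i, rfl⟩
    have h0 := hgen u v ⟨u, v, hu, hv, rfl, hqW⟩ hHz hu hYu hmemA p hp
    rw [hΨ]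
    exact mul_eq_zero_of_right _ h0
  have hΨP : Ψ ∈ vanishingIdeal K (bicone W) :=
    (hP.mem_or_mem hprod).resolve_left fun h => (hP.mem_or_mem h).elim hH hδP
  have := eval_eq_zero_of_mem hΨP hmem
  rwa [hΨ] at this

end Desingularization

end Focal

end

/-! ### The main theorem: discarding the components that do not dominate `B`. -/

open Focal in
theorem theorem3 {K : Type*} [Field K] [IsAlgClosed K] [CharZero K] {N k n : ℕ}
    (hn : n + k ≤ N)
    (B : Set (Grass K N k)) (hB_closed : IsClosed B) (hB_irred : IsIrreducible B)
    (hB_dim : topologicalKrullDim B = (n : WithBot ℕ∞))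
    (D : Desingularization B)
    (hX_dim : topologicalKrullDim (sweptOut B) = ((n + k : ℕ) : WithBot ℕ∞))
    (hF_codim : topologicalKrullDim D.focalLocus + 1 = ((n + k : ℕ) : WithBot ℕ∞))
    (hF_components : ∀ W : Set (BiProjSpace K D.M N), D.IsFocalComponent W →
      B ⊆ closure (D.imageInBase W) →
      ¬ D.imageInSpace W ⊆ D.fundamentalLocus →
      topologicalKrullDim (D.imageInSpace W) + 1 = ((n + k : ℕ) : WithBot ℕ∞)) :
    ∃ O : Set (Grass K N k), IsOpen O ∧ (B ∩ O).Nonempty ∧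
      ∀ L ∈ B ∩ O, ∀ b : D.carrier, D.toGrass b = L →
        ∀ x : ProjSpace K N, ((b.1, x) : BiProjSpace K D.M N) ∈ D.foci →
          x ∉ D.fundamentalLocus → L.1 ≤ embTangent D.focalLocus x := by
  obtain ⟨C, hC, hCmax, hCmem⟩ := exists_finite_maximal_isIrreducible D.foci
  have hC' : {W ∈ C | ¬ B ⊆ closure (D.imageInBase W)}.Finite := hC.subset (Set.sep_subset _ _)
  -- Finitely many closed sets are removed, none containing the irreducible `B`. The component of
  -- any remaining focus dominates `B`, and `x` shows that its image is not contained in the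
  -- fundamental locus.
  refine ⟨(⋃ W ∈ {W ∈ C | ¬ B ⊆ closure (D.imageInBase W)}, closure (D.imageInBase W))ᶜ,
    (hC'.isClosed_biUnion fun _ _ => isClosed_closure).isOpen_compl,
    IsIrreducible.nonempty_inter_compl_biUnion hB_irred hC' (fun _ _ => isClosed_closure)
      fun W hW => hW.2, ?_⟩
  rintro L ⟨-, hL⟩ b rfl x hq hx
  obtain ⟨W, hWC, hqW⟩ := hCmem _ hq
  have hdom : B ⊆ closure (D.imageInBase W) := by
    by_contra hcon
    exact hL (Set.mem_biUnion (x := W) ⟨hWC, hcon⟩ (subset_closure ⟨_, hqW, b.2, rfl⟩))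
  exact D.le_embTangent_of_mem hB_dim (hCmax W hWC).1.1 (hCmax W hWC).1.2
    (hF_components W (hCmax W hWC) hdom fun hcon => hx (hcon ⟨_, hqW, rfl⟩)) hqW b.2
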